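/- Let $k$ be a fixed integer. For a positive integer $q$ let $$\lambda(q;k)=\#\{(x,y,z)\in\mathbb Z^3:\ 1\le x,y,z\le q,\ x^2+y^2+z^2+k\equiv 0 \pmod q\},$$ and for a real number $H\ge 1$ let $S_3(H,k)$ be the number of triples of integers $(x,y,z)$ with $1\le x,y,z\le H$ such that $x^2+y^2+z^2+k$ is square-free (an integer is square-free if it is not divisible by $p^2$ for any prime $p$; in particular $0$ is not square-free). Then the product $\prod_p\bigl(1-\lambda(p^2;k)/p^6\bigr)$ over all primes $p$ converges, and for every $\varepsilon>0$, as $H\to\infty$, $$S_3(H,k)=\prod_p\left(1-\frac{\lambda(p^2;k)}{p^6}\right)H^3+O\bigl(H^{9/4+\varepsilon}\bigr),$$ where the implied constant may depend only on $k$ and $\varepsilon$. -/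

import Mathlib

/-- `lambda q k` is the number of triples `1 ≤ x, y, z ≤ q` of integers with
`x² + y² + z² + k ≡ 0 (mod q)`. -/
def lambda (q : ℕ) (k : ℤ) : ℕ :=
  ((Finset.Icc 1 q ×ˢ Finset.Icc 1 q ×ˢ Finset.Icc 1 q).filter
    fun t : ℕ × ℕ × ℕ =>
      (t.1 : ℤ) ^ 2 + (t.2.1 : ℤ) ^ 2 + (t.2.2 : ℤ) ^ 2 + k ≡ 0 [ZMOD (q : ℤ)]).card

open Classical in
/-- `S3 H k` is the number of triples of integers `1 ≤ x, y, z ≤ H` (`H` real) for which the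
integer `x² + y² + z² + k` is square-free. The integer `0` is not square-free, and a negative
integer is square-free exactly when its absolute value is. -/
noncomputable def S3 (H : ℝ) (k : ℤ) : ℕ :=
  ((Finset.Icc 1 ⌊H⌋₊ ×ˢ Finset.Icc 1 ⌊H⌋₊ ×ˢ Finset.Icc 1 ⌊H⌋₊).filter
    fun t : ℕ × ℕ × ℕ =>
      Squarefree ((t.1 : ℤ) ^ 2 + (t.2.1 : ℤ) ^ 2 + (t.2.2 : ℤ) ^ 2 + k)).card

/-! Write the indicator of square-free `n ≠ 0` as the sum of `μ(d)` over `d² ∣ n`, and cut the sum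
over `d` at `D = ⌊N^(3/4)⌋`, where `N = ⌊H⌋`. Points where the polynomial vanishes are divisible by
every `d²` and are removed beforehand; there are at most `|k|³` of them.

For `d ≤ D`, the points of `[1, N]³` on the quadric modulo `d²` are counted by completion. The zero
frequency gives the main term `λ(d²) N³ / d⁶`. At frequency `(a, b, c)` the quadric is detected by
an extra variable `t`, and translating all four variables by multiples of `d` leaves only the points
where the gradient of the phase vanishes modulo `d` (`norm_quadricSum_le`). Prime by prime, these
number at most `τ(d)⁴ gcd(d, a² + b² + c²) gcd(d, a, b, c)` (`card_critSystem_le`). A nonzero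
integer frequency has `a² + b² + c² ≠ 0`, so the first gcd is `O(τ)` on average over `d`
(`sum_gcd_le`). The total error is `N^ε (D³ + N D + N²)` (`exists_sum_abs_boxError_le`).

For `d > D`, write the value as `d² m`. Given `x, d, m`, the pair `(y, z)` represents a fixed
positive integer as a sum of two squares, in `O(N^ε)` ways, and there are `O(N · N² / D)` triples
`(x, d, m)`. The contribution is `N^(3 + ε) / D` (`exists_card_largeDivisorPairs_le`).

Truncating the singular series, whose terms are `O(d^(-2 + ε))`, also costs `N^(3 + ε) / D`. The
choice of `D` balances `D³` against `N³ / D`, both of size `N^(9/4)`. The terms of the series are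
multiplicative in `d`, which gives the Euler product (`hasProd_singular`). -/

/-! ### Divisor bound, gcd sums and harmonic sums -/

lemma exists_add_one_le_mul_two_rpow {ε : ℝ} (hε : 0 < ε) :
    ∃ K : ℝ, 1 ≤ K ∧ ∀ e : ℕ, (e : ℝ) + 1 ≤ K * (2 : ℝ) ^ (ε * e) := by
  have hl : 0 < ε * Real.log 2 := mul_pos hε (Real.log_pos one_lt_two)
  -- From `exp u ≥ 1 + u` with `u = ε e log 2`; the summand `1 / (ε log 2)` turns `u` back into `e`.
  refine ⟨1 + 1 / (ε * Real.log 2), by simp; positivity, fun e => ?_⟩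
  have h1 : (2 : ℝ) ^ (ε * e) = Real.exp (ε * Real.log 2 * e) := by
    rw [Real.rpow_def_of_pos two_pos]; ring_nf
  have h2 : ε * Real.log 2 * e + 1 ≤ (2 : ℝ) ^ (ε * e) := by
    rw [h1]; exact Real.add_one_le_exp _
  calc (e : ℝ) + 1 ≤ (1 + 1 / (ε * Real.log 2)) * (ε * Real.log 2 * e + 1) := by
        have : (1 + 1 / (ε * Real.log 2)) * (ε * Real.log 2 * e + 1)
            = ε * Real.log 2 * e + 1 + e + 1 / (ε * Real.log 2) := by field_simp; ring
        rw [this]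
        have : 0 ≤ ε * Real.log 2 * e := by positivity
        have : 0 ≤ 1 / (ε * Real.log 2) := by positivity
        linarith
    _ ≤ _ := by gcongr

/-- The divisor bound: `τ(n) ≪ n ^ ε`. -/
theorem exists_card_divisors_le {ε : ℝ} (hε : 0 < ε) :
    ∃ C : ℝ, 1 ≤ C ∧ ∀ n : ℕ, n ≠ 0 → (n.divisors.card : ℝ) ≤ C * (n : ℝ) ^ ε := by
  obtain ⟨K, hK1, hK⟩ := exists_add_one_le_mul_two_rpow hε
  -- A prime `p ≥ B` has `p ^ ε ≥ 2`, hence `e + 1 ≤ 2 ^ e ≤ p ^ (ε e)` at no cost. Only primes in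
  -- `range (B + 1)` are charged a factor `K`, whence the constant `K ^ (B + 1)`.
  obtain ⟨B, hB⟩ := exists_nat_ge ((2 : ℝ) ^ (1 / ε))
  refine ⟨K ^ (B + 1), one_le_pow₀ hK1, fun n hn => ?_⟩
  have hloc : ∀ p ∈ n.primeFactors, ((n.factorization p + 1 : ℕ) : ℝ) ≤
      (if p ∈ Finset.range (B + 1) then K else 1) * ((p : ℝ) ^ n.factorization p) ^ ε := by
    intro p hp
    have hp2 : (2 : ℝ) ≤ p := by exact_mod_cast (Nat.prime_of_mem_primeFactors hp).two_le
    have hpow : ((p : ℝ) ^ n.factorization p) ^ ε = (p : ℝ) ^ (ε * n.factorization p) := by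
      rw [← Real.rpow_natCast, ← Real.rpow_mul (by positivity), mul_comm]
    push_cast
    split_ifs with h
    · refine (hK _).trans ?_
      rw [hpow]
      gcongr
    · have hp : (2 : ℝ) ^ (1 / ε) ≤ p := hB.trans (by
        simp only [Finset.mem_range, not_lt] at h
        exact_mod_cast (by omega : B ≤ p))
      have h2 : (2 : ℝ) ≤ (p : ℝ) ^ ε := by
        calc (2 : ℝ) = ((2 : ℝ) ^ (1 / ε)) ^ ε := by
              rw [← Real.rpow_mul (by norm_num), one_div_mul_cancel hε.ne', Real.rpow_one]
          _ ≤ _ := by gcongr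
      rw [one_mul, hpow, Real.rpow_mul (by positivity), Real.rpow_natCast]
      calc (n.factorization p : ℝ) + 1 ≤ 2 ^ n.factorization p := by
            exact_mod_cast Nat.lt_two_pow_self
        _ ≤ _ := by gcongr
  calc (n.divisors.card : ℝ) = ∏ p ∈ n.primeFactors, ((n.factorization p + 1 : ℕ) : ℝ) := by
        rw [Nat.card_divisors hn]; push_cast; rfl
    _ ≤ ∏ p ∈ n.primeFactors, ((if p ∈ Finset.range (B + 1) then K else 1) *
          ((p : ℝ) ^ n.factorization p) ^ ε) :=
        Finset.prod_le_prod (fun _ _ => by positivity) hloc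
    _ = K ^ (n.primeFactors.filter (· ∈ Finset.range (B + 1))).card * (n : ℝ) ^ ε := by
        rw [Finset.prod_mul_distrib, Real.finsetProd_rpow _ _ (fun _ _ => by positivity)]
        congr 1
        · rw [← Finset.prod_filter, Finset.prod_const]
        · congr 1
          conv_rhs => rw [← Nat.prod_factorization_pow_eq_self hn]
          rw [Finsupp.prod, Nat.support_factorization]
          push_cast; rfl
    _ ≤ K ^ (B + 1) * (n : ℝ) ^ ε := by
        gcongr
        calc _ ≤ (Finset.range (B + 1)).card := Finset.card_le_card (fun x hx => by
                simpa using (Finset.mem_filter.1 hx).2)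
          _ = _ := by simp

lemma gcd_le_sum_ite (m n : ℕ) (hn : n ≠ 0) :
    Nat.gcd m n ≤ ∑ f ∈ n.divisors, if f ∣ m then f else 0 := by
  have h : Nat.gcd m n ∈ n.divisors := Nat.mem_divisors.2 ⟨Nat.gcd_dvd_right _ _, hn⟩
  refine le_trans ?_ (Finset.single_le_sum (f := fun f => if f ∣ m then f else 0)
    (fun _ _ => Nat.zero_le _) h)
  simp [Nat.gcd_dvd_left]

lemma sum_Icc_ite_dvd (D f : ℕ) (g : ℕ → ℝ) (hf : 0 < f) :
    ∑ d ∈ Finset.Icc 1 D, (if f ∣ d then g d else 0) = ∑ j ∈ Finset.Icc 1 (D / f), g (f * j) := by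
  rw [← Finset.sum_filter]
  symm
  refine Finset.sum_bij (fun j _ => f * j) ?_ ?_ ?_ ?_
  · intro j hj
    simp only [Finset.mem_Icc, Finset.mem_filter, dvd_mul_right, and_true] at hj ⊢
    exact ⟨Nat.mul_pos hf hj.1, by rw [mul_comm]; exact (Nat.le_div_iff_mul_le hf).1 hj.2⟩
  · intro a _ b _ h
    exact Nat.eq_of_mul_eq_mul_left hf h
  · intro d hd
    simp only [Finset.mem_Icc, Finset.mem_filter] at hd
    obtain ⟨⟨h1, h2⟩, j, rfl⟩ := hd
    refine ⟨j, ?_, rfl⟩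
    simp only [Finset.mem_Icc]
    refine ⟨Nat.pos_of_mul_pos_left h1, (Nat.le_div_iff_mul_le hf).2 (by rwa [mul_comm])⟩
  · intros; rfl

/-- The gcd is at most the sum of all common divisors `f`, and each `f ∣ n` contributes `f ⌊D / f⌋ ≤
D`. -/
theorem sum_gcd_le (D n : ℕ) (hn : n ≠ 0) :
    ∑ d ∈ Finset.Icc 1 D, (Nat.gcd d n : ℝ) ≤ D * n.divisors.card := by
  calc ∑ d ∈ Finset.Icc 1 D, (Nat.gcd d n : ℝ)
      ≤ ∑ d ∈ Finset.Icc 1 D, ∑ f ∈ n.divisors, (if f ∣ d then (f : ℝ) else 0) := by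
        refine Finset.sum_le_sum fun d _ => ?_
        exact_mod_cast gcd_le_sum_ite d n hn
    _ = ∑ f ∈ n.divisors, ∑ d ∈ Finset.Icc 1 D, (if f ∣ d then (f : ℝ) else 0) :=
        Finset.sum_comm
    _ ≤ ∑ f ∈ n.divisors, (D : ℝ) := by
        refine Finset.sum_le_sum fun f hf => ?_
        have hf0 := Nat.pos_of_mem_divisors hf
        rw [sum_Icc_ite_dvd D f (fun _ => (f : ℝ)) hf0]
        simp only [Finset.sum_const, Nat.card_Icc, add_tsub_cancel_right, nsmul_eq_mul]
        exact_mod_cast Nat.div_mul_le_self D f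
    _ = _ := by simp [mul_comm]

/-- `∑_{i ≤ A, j ≤ B} gcd(i, j) / (i j)` is at most a product of harmonic sums. -/
theorem sum_gcd_div_mul_le (A B : ℕ) :
    ∑ i ∈ Finset.Icc 1 A, ∑ j ∈ Finset.Icc 1 B, (Nat.gcd i j : ℝ) / (i * j) ≤
      (∑ i ∈ Finset.Icc 1 A, (1 : ℝ) / i) ^ 2 * ∑ j ∈ Finset.Icc 1 B, (1 : ℝ) / j := by
  have hinner : ∀ (M f : ℕ), 0 < f → ∑ i ∈ Finset.Icc 1 M, (if f ∣ i then (1 : ℝ) / i else 0) ≤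
      (1 / f) * ∑ i ∈ Finset.Icc 1 M, (1 : ℝ) / i := by
    intro M f hf
    rw [sum_Icc_ite_dvd M f (fun i => (1 : ℝ) / i) hf, Finset.mul_sum]
    refine (Finset.sum_le_sum_of_subset_of_nonneg
      (Finset.Icc_subset_Icc le_rfl (Nat.div_le_self M f)) (fun _ _ _ => by positivity)).trans ?_
    refine Finset.sum_le_sum fun i _ => ?_
    push_cast
    rw [div_mul_div_comm, one_mul]
  -- Bounding the gcd by the sum of the common divisors `f` makes the double sum factor. Each of the
  -- two factors gains `1 / f`, so `f · f⁻² = 1 / f` is left and sums to the third harmonic sum.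
  calc ∑ i ∈ Finset.Icc 1 A, ∑ j ∈ Finset.Icc 1 B, (Nat.gcd i j : ℝ) / (i * j)
      ≤ ∑ i ∈ Finset.Icc 1 A, ∑ j ∈ Finset.Icc 1 B, ∑ f ∈ Finset.Icc 1 A,
          (f : ℝ) * ((if f ∣ i then (1 : ℝ) / i else 0) * (if f ∣ j then (1 : ℝ) / j else 0)) := by
        refine Finset.sum_le_sum fun i hi => Finset.sum_le_sum fun j hj => ?_
        have hi' := Finset.mem_Icc.1 hi
        have hg : Nat.gcd i j ∈ Finset.Icc 1 A := Finset.mem_Icc.2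
          ⟨Nat.gcd_pos_of_pos_left _ hi'.1, (Nat.gcd_le_left _ hi'.1).trans hi'.2⟩
        refine le_trans (le_of_eq ?_) (Finset.single_le_sum (f := fun f : ℕ => (f : ℝ) *
          ((if f ∣ i then (1 : ℝ) / i else 0) * (if f ∣ j then (1 : ℝ) / j else 0)))
          (fun f _ => by positivity) hg)
        simp only [Nat.gcd_dvd_left, Nat.gcd_dvd_right, if_true]
        rw [div_mul_div_comm, one_mul, mul_one_div]
    _ = ∑ f ∈ Finset.Icc 1 A, (f : ℝ) * ((∑ i ∈ Finset.Icc 1 A, (if f ∣ i then (1 : ℝ) / i else 0)) *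
          ∑ j ∈ Finset.Icc 1 B, (if f ∣ j then (1 : ℝ) / j else 0)) := by
        simp_rw [Finset.sum_mul_sum, Finset.mul_sum]
        conv_lhs =>
          enter [2, x]
          rw [Finset.sum_comm]
        rw [Finset.sum_comm]
    _ ≤ ∑ f ∈ Finset.Icc 1 A, (f : ℝ) * (((1 / f) * ∑ i ∈ Finset.Icc 1 A, (1 : ℝ) / i) *
          ((1 / f) * ∑ j ∈ Finset.Icc 1 B, (1 : ℝ) / j)) := by
        refine Finset.sum_le_sum fun f hf => ?_
        have hf0 := (Finset.mem_Icc.1 hf).1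
        gcongr
        · exact hinner A f hf0
        · exact hinner B f hf0
    _ = _ := by
        rw [sq, mul_assoc, Finset.sum_mul]
        refine Finset.sum_congr rfl fun f hf => ?_
        have hf0 : (f : ℝ) ≠ 0 := by
          have := (Finset.mem_Icc.1 hf).1
          positivity
        field_simp

theorem exists_harmonic_le {ε : ℝ} (hε : 0 < ε) :
    ∃ C : ℝ, 1 ≤ C ∧ ∀ A : ℕ, 1 ≤ A → ∑ i ∈ Finset.Icc 1 A, (1 : ℝ) / i ≤ C * (A : ℝ) ^ ε := by
  refine ⟨1 + 1 / ε, by simp; positivity, fun A hA => ?_⟩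
  have h := harmonic_le_one_add_log A
  rw [harmonic_eq_sum_Icc] at h
  push_cast at h
  have hA' : (1 : ℝ) ≤ A := by exact_mod_cast hA
  have h1 : (1 : ℝ) ≤ (A : ℝ) ^ ε := Real.one_le_rpow hA' hε.le
  have h2 : Real.log A ≤ (A : ℝ) ^ ε / ε := Real.log_le_rpow_div (by positivity) hε
  simp only [one_div]
  calc _ ≤ _ := h
    _ ≤ (A : ℝ) ^ ε + (A : ℝ) ^ ε / ε := by gcongr
    _ = _ := by field_simp

/-! ### Representations as a sum of two squares -/

/-- Two primitive representations of `n` which have the same greatest common divisor with the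
cross product relative to a third one are congruent modulo `n / 2`. -/
lemma dvd_two_mul_cross_of_gcd_eq {n y₀ z₀ y₁ z₁ y₂ z₂ : ℤ} (hn : n ≠ 0)
    (h₀ : y₀ ^ 2 + z₀ ^ 2 = n) (h₁ : y₁ ^ 2 + z₁ ^ 2 = n) (h₂ : y₂ ^ 2 + z₂ ^ 2 = n)
    (c₀ : IsCoprime y₀ z₀) (c₁ : IsCoprime y₁ z₁)
    (hu : Int.gcd n (y₁ * z₀ - y₀ * z₁) = Int.gcd n (y₂ * z₀ - y₀ * z₂)) :
    n ∣ 2 * (y₁ * z₂ - y₂ * z₁) := by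
  set u : ℤ := (Int.gcd n (y₁ * z₀ - y₀ * z₁) : ℤ) with hu_def
  have hun : u ∣ n := Int.gcd_dvd_left ..
  have hu1 : u ∣ y₁ * z₀ - y₀ * z₁ := Int.gcd_dvd_right ..
  have hu2 : u ∣ y₂ * z₀ - y₀ * z₂ := by rw [hu_def, hu]; exact Int.gcd_dvd_right ..
  obtain ⟨v, hv⟩ := hun
  have hu0 : u ≠ 0 := by rintro h; rw [h, zero_mul] at hv; exact hn hv
  -- The product `(y z₀ - y₀ z)(y z₀ + y₀ z)` is a multiple of `n = u v`. Since `u` is the exact gcd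
  -- of `n` with the first factor, the cofactor `w` is prime to `v`, so `v` divides the second.
  have key : ∀ y z : ℤ, y ^ 2 + z ^ 2 = n → u = (Int.gcd n (y * z₀ - y₀ * z) : ℤ) →
      v ∣ y * z₀ + y₀ * z := by
    intro y z h hg
    obtain ⟨w, hw⟩ : u ∣ y * z₀ - y₀ * z := by rw [hg]; exact Int.gcd_dvd_right ..
    have hcop : IsCoprime v w := by
      rw [Int.isCoprime_iff_gcd_eq_one]
      have : Int.gcd (u * v) (u * w) = u.natAbs * Int.gcd v w := Int.gcd_mul_left ..
      rw [← hv, ← hw] at this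
      have h3 : Int.gcd n (y * z₀ - y₀ * z) = u.natAbs := by rw [hg]; simp
      rw [h3] at this
      have hpos : 0 < u.natAbs := Int.natAbs_pos.2 hu0
      exact (Nat.eq_of_mul_eq_mul_left hpos (by simpa using this)).symm
    have hprod : (y * z₀ - y₀ * z) * (y * z₀ + y₀ * z) = n * (y ^ 2 - y₀ ^ 2) := by
      linear_combination y ^ 2 * h₀ - y₀ ^ 2 * h
    rw [hw, hv, mul_assoc, mul_assoc] at hprod
    have := mul_left_cancel₀ hu0 hprod
    exact hcop.dvd_of_dvd_mul_left ⟨_, this⟩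
  have hv1 := key y₁ z₁ h₁ rfl
  have hv2 := key y₂ z₂ h₂ (by rw [hu_def, hu])
  -- a multiple of the cross product by `y₀` or `z₀` lies in both `(u)` and `(v)`
  have e1 : u ∣ z₀ * (y₁ * z₂ - y₂ * z₁) := by
    have : z₀ * (y₁ * z₂ - y₂ * z₁) = z₂ * (y₁ * z₀ - y₀ * z₁) - z₁ * (y₂ * z₀ - y₀ * z₂) := by ring
    rw [this]; exact dvd_sub (hu1.mul_left _) (hu2.mul_left _)
  have e2 : u ∣ y₀ * (y₁ * z₂ - y₂ * z₁) := by
    have : y₀ * (y₁ * z₂ - y₂ * z₁) = y₂ * (y₁ * z₀ - y₀ * z₁) - y₁ * (y₂ * z₀ - y₀ * z₂) := by ring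
    rw [this]; exact dvd_sub (hu1.mul_left _) (hu2.mul_left _)
  have f1 : v ∣ z₀ * (y₁ * z₂ - y₂ * z₁) := by
    have : z₀ * (y₁ * z₂ - y₂ * z₁) = z₂ * (y₁ * z₀ + y₀ * z₁) - z₁ * (y₂ * z₀ + y₀ * z₂) := by ring
    rw [this]; exact dvd_sub (hv1.mul_left _) (hv2.mul_left _)
  have f2 : v ∣ y₀ * (y₁ * z₂ - y₂ * z₁) := by
    have : y₀ * (y₁ * z₂ - y₂ * z₁) = -(y₂ * (y₁ * z₀ + y₀ * z₁) - y₁ * (y₂ * z₀ + y₀ * z₂)) := by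
      ring
    rw [this]; exact (dvd_sub (hv1.mul_left _) (hv2.mul_left _)).neg_right
  have hX : ∀ w : ℤ, w ∣ z₀ * (y₁ * z₂ - y₂ * z₁) → w ∣ y₀ * (y₁ * z₂ - y₂ * z₁) →
      w ∣ y₁ * z₂ - y₂ * z₁ := by
    intro w hw1 hw2
    obtain ⟨α, β, hαβ⟩ := c₀
    have : y₁ * z₂ - y₂ * z₁ =
        α * (y₀ * (y₁ * z₂ - y₂ * z₁)) + β * (z₀ * (y₁ * z₂ - y₂ * z₁)) := by
      linear_combination -(y₁ * z₂ - y₂ * z₁) * hαβ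
    rw [this]; exact dvd_add (hw2.mul_left _) (hw1.mul_left _)
  obtain ⟨X₁, hX₁⟩ := hX u e1 e2
  obtain ⟨X₂, hX₂⟩ := hX v f1 f2
  -- A common divisor of `u` and `v` divides the sum `2 y₁ z₀` of the two forms, and `y₁`, `z₀` are
  -- prime to `n`. With Bézout for `u, v`, divisibility by both `u` and `v` then gives divisibility
  -- by `u v` after doubling.
  have hg2 : (Int.gcd u v : ℤ) ∣ 2 := by
    set g : ℤ := (Int.gcd u v : ℤ)
    have hgu : g ∣ u := Int.gcd_dvd_left ..
    have hgv : g ∣ v := Int.gcd_dvd_right ..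
    have hgn : g ∣ n := hgu.trans ⟨v, hv⟩
    have hgs : g ∣ 2 * (y₁ * z₀) := by
      have : 2 * (y₁ * z₀) = (y₁ * z₀ - y₀ * z₁) + (y₁ * z₀ + y₀ * z₁) := by ring
      rw [this]; exact dvd_add (hgu.trans hu1) (hgv.trans hv1)
    have k1 : IsCoprime n y₁ := by
      have := (c₁.symm.pow_left (m := 2)).add_mul_right_left y₁
      rwa [show z₁ ^ 2 + y₁ * y₁ = n by rw [← h₁]; ring] at this
    have k0 : IsCoprime n z₀ := by
      have := (c₀.pow_left (m := 2)).add_mul_right_left z₀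
      rwa [show y₀ ^ 2 + z₀ * z₀ = n by rw [← h₀]; ring] at this
    exact ((k1.mul_right k0).of_isCoprime_of_dvd_left hgn).dvd_of_dvd_mul_right hgs
  obtain ⟨w, hw⟩ := hg2
  refine ⟨w * (Int.gcdA u v * X₂ + Int.gcdB u v * X₁), ?_⟩
  rw [hv, hw, Int.gcd_eq_gcd_ab]
  linear_combination (u * Int.gcdA u v * w) * hX₂ + (v * Int.gcdB u v * w) * hX₁

/-- Equal cross products make the difference of the two points proportional to `(y₁, z₁)`, whose
coordinates are positive. Both coordinates would then grow together, which is impossible on a circle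
in the positive quadrant. -/
lemma eq_of_cross_eq {n y₁ z₁ y₂ z₂ y₃ z₃ : ℤ} (hy₁ : 0 < y₁) (hz₁ : 0 < z₁)
    (hy₂ : 0 < y₂) (hz₂ : 0 < z₂) (hy₃ : 0 < y₃) (hz₃ : 0 < z₃)
    (h₂ : y₂ ^ 2 + z₂ ^ 2 = n) (h₃ : y₃ ^ 2 + z₃ ^ 2 = n)
    (h : y₁ * z₂ - y₂ * z₁ = y₁ * z₃ - y₃ * z₁) : y₂ = y₃ ∧ z₂ = z₃ := by
  have h' : y₁ * (z₂ - z₃) = z₁ * (y₂ - y₃) := by linarith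
  rcases lt_trichotomy y₂ y₃ with hlt | heq | hgt
  · have : z₂ - z₃ < 0 := by
      by_contra hcon
      push Not at hcon
      have := mul_nonneg hy₁.le hcon
      have := mul_pos hz₁ (sub_pos.2 hlt)
      linarith
    nlinarith
  · subst heq
    refine ⟨rfl, ?_⟩
    rw [sub_self, mul_zero] at h'
    rcases mul_eq_zero.1 h' with h0 | h0 <;> omega
  · have : 0 < z₂ - z₃ := by
      by_contra hcon
      push Not at hcon
      have := mul_nonneg hy₁.le (neg_nonneg.2 hcon)
      have := mul_pos hz₁ (sub_pos.2 hgt)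
      linarith
    nlinarith

/-- Fix one representation `p₀` and sort the others by the gcd of `n` with their cross product with
`p₀`, a divisor of `n`. Within a class containing `p₁`, twice the cross product with `p₁` is a
multiple of `n` lying strictly between `-2n` and `2n`. It takes at most three values, and each
determines the representation. -/
lemma card_primitive_sum_two_squares_le (n : ℕ) (hn : n ≠ 0) (s : Finset (ℕ × ℕ))
    (hs : ∀ p ∈ s, 0 < p.1 ∧ 0 < p.2 ∧ p.1 ^ 2 + p.2 ^ 2 = n ∧ Nat.Coprime p.1 p.2) :
    s.card ≤ 3 * n.divisors.card := by
  classical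
  rcases s.eq_empty_or_nonempty with rfl | ⟨p₀, hp₀⟩
  · simp
  obtain ⟨-, -, e₀, c₀⟩ := hs p₀ hp₀
  refine Finset.card_le_mul_card_image_of_maps_to
    (f := fun p => Int.gcd (n : ℤ) ((p.1 : ℤ) * p₀.2 - p₀.1 * p.2)) (fun p _ => ?_) 3 ?_
  · rw [Nat.mem_divisors]
    exact ⟨by exact_mod_cast Int.gcd_dvd_left (n : ℤ) ((p.1 : ℤ) * p₀.2 - p₀.1 * p.2), hn⟩
  · intro u _
    set t := s.filter (fun p => Int.gcd (n : ℤ) ((p.1 : ℤ) * p₀.2 - p₀.1 * p.2) = u) with ht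
    rcases t.eq_empty_or_nonempty with h0 | ⟨p₁, hp₁⟩
    · simp [h0]
    obtain ⟨hp₁s, hu₁⟩ := Finset.mem_filter.1 hp₁
    obtain ⟨hy₁, hz₁, e₁, c₁⟩ := hs p₁ hp₁s
    have hcard : ({0, (n : ℤ), -(n : ℤ)} : Finset ℤ).card ≤ 3 := Finset.card_le_three
    refine le_trans (Finset.card_le_card_of_injOn
      (fun p => 2 * ((p₁.1 : ℤ) * p.2 - p.1 * p₁.2)) ?_ ?_) hcard
    · intro p hp
      obtain ⟨hps, hup⟩ := Finset.mem_filter.1 hp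
      obtain ⟨hy, hz, e, c⟩ := hs p hps
      obtain ⟨w, hw⟩ := dvd_two_mul_cross_of_gcd_eq (n := n) (y₀ := p₀.1) (z₀ := p₀.2)
        (y₁ := p₁.1) (z₁ := p₁.2) (y₂ := p.1) (z₂ := p.2) (by exact_mod_cast hn)
        (by exact_mod_cast e₀) (by exact_mod_cast e₁) (by exact_mod_cast e)
        (Nat.isCoprime_iff_coprime.2 c₀) (Nat.isCoprime_iff_coprime.2 c₁) (by rw [hu₁, hup])
      -- By `2 y₁ z ≤ y₁² + z²`, where each square is less than `n`; the other product only helps.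
      -- The lower bound is symmetric.
      have b1 : 2 * ((p₁.1 : ℤ) * p.2 - p.1 * p₁.2) < 2 * n := by
        zify at e e₁ hy hz hy₁ hz₁
        nlinarith [sq_nonneg ((p₁.1 : ℤ) - p.2), mul_pos hy hz₁, mul_pos hy hy, mul_pos hz₁ hz₁]
      have b2 : -(2 * n : ℤ) < 2 * ((p₁.1 : ℤ) * p.2 - p.1 * p₁.2) := by
        zify at e e₁ hy hz hy₁ hz₁
        nlinarith [sq_nonneg ((p₁.2 : ℤ) - p.1), mul_pos hy₁ hz, mul_pos hy₁ hy₁, mul_pos hz hz]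
      have hn0 : (0 : ℤ) < n := by exact_mod_cast Nat.pos_of_ne_zero hn
      have w1 : w < 2 := by
        rw [hw] at b1; nlinarith
      have w2 : -2 < w := by
        rw [hw] at b2; nlinarith
      simp only [Finset.coe_insert, Finset.coe_singleton, Set.mem_insert_iff,
        Set.mem_singleton_iff, hw]
      obtain rfl | rfl | rfl : w = 0 ∨ w = 1 ∨ w = -1 := by omega
      all_goals simp
    · intro p hp p' hp' h
      obtain ⟨hps, -⟩ := Finset.mem_filter.1 hp
      obtain ⟨hps', -⟩ := Finset.mem_filter.1 hp'
      obtain ⟨hy, hz, e, -⟩ := hs p hps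
      obtain ⟨hy', hz', e', -⟩ := hs p' hps'
      have := eq_of_cross_eq (n := n) (y₁ := p₁.1) (z₁ := p₁.2) (y₂ := p.1) (z₂ := p.2)
        (y₃ := p'.1) (z₃ := p'.2) (by exact_mod_cast hy₁) (by exact_mod_cast hz₁)
        (by exact_mod_cast hy) (by exact_mod_cast hz) (by exact_mod_cast hy')
        (by exact_mod_cast hz') (by exact_mod_cast e) (by exact_mod_cast e')
        (mul_left_cancel₀ two_ne_zero h)
      exact Prod.ext (by exact_mod_cast this.1) (by exact_mod_cast this.2)

/-- The number of representations of `n` as a sum of two positive squares is `O(τ(n)²)`. -/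
theorem card_sum_two_squares_le (n : ℕ) (hn : n ≠ 0) (s : Finset (ℕ × ℕ))
    (hs : ∀ p ∈ s, 0 < p.1 ∧ 0 < p.2 ∧ p.1 ^ 2 + p.2 ^ 2 = n) :
    s.card ≤ 3 * n.divisors.card * n.divisors.card := by
  classical
  refine Finset.card_le_mul_card_image_of_maps_to
    (f := fun p => Nat.gcd p.1 p.2) (fun p hp => ?_) _ ?_
  · obtain ⟨hy, hz, e⟩ := hs p hp
    rw [Nat.mem_divisors]
    refine ⟨?_, hn⟩
    rw [← e, sq, sq]
    exact dvd_add ((Nat.gcd_dvd_left _ _).mul_right _) ((Nat.gcd_dvd_right _ _).mul_right _)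
  -- Dividing by the gcd `g` gives primitive representations of `n / g²`, which has no more divisors
  -- than `n`.
  · intro g _
    set t := s.filter (fun p => Nat.gcd p.1 p.2 = g) with ht
    have hmem : ∀ p ∈ t, ∃ y z, 0 < g ∧ p = (g * y, g * z) ∧ 0 < y ∧ 0 < z ∧
        g ^ 2 * (y ^ 2 + z ^ 2) = n ∧ Nat.Coprime y z := by
      rintro ⟨y, z⟩ hp
      obtain ⟨hps, hg⟩ := Finset.mem_filter.1 hp
      obtain ⟨hy, hz, e⟩ := hs _ hps
      simp only at hy hz e hg
      have hg0 : 0 < g := by rw [← hg]; exact Nat.gcd_pos_of_pos_left _ hy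
      obtain ⟨y', z', hc, hy', hz'⟩ := Nat.exists_coprime y z
      rw [hg] at hy' hz'
      subst hy' hz'
      refine ⟨y', z', hg0, by simp [mul_comm], Nat.pos_of_mul_pos_right hy,
        Nat.pos_of_mul_pos_right hz, by rw [← e]; ring, hc⟩
    rcases t.eq_empty_or_nonempty with h0 | ⟨p₁, hp₁⟩
    · simp [h0]
    obtain ⟨y₁, z₁, hg0, -, -, -, e₁, -⟩ := hmem p₁ hp₁
    have hn' : n / g ^ 2 = y₁ ^ 2 + z₁ ^ 2 := by
      rw [← e₁]; exact Nat.mul_div_cancel_left _ (by positivity)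
    have hdvd : n / g ^ 2 ∣ n := Nat.div_dvd_of_dvd ⟨_, e₁.symm⟩
    have hn0 : n / g ^ 2 ≠ 0 := fun h => hn (by
      obtain ⟨c, hc⟩ := hdvd; rw [hc, h, zero_mul])
    have hinj : Set.InjOn (fun p : ℕ × ℕ => (p.1 / g, p.2 / g)) t := by
      intro p hp p' hp' h
      obtain ⟨y, z, -, rfl, -⟩ := hmem p hp
      obtain ⟨y', z', -, rfl, -⟩ := hmem p' hp'
      simp only [Nat.mul_div_cancel_left _ hg0, Prod.mk.injEq] at h
      rw [h.1, h.2]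
    rw [← Finset.card_image_of_injOn hinj]
    refine (card_primitive_sum_two_squares_le (n / g ^ 2) hn0 _ ?_).trans
      (Nat.mul_le_mul_left _ (Finset.card_le_card (Nat.divisors_subset_of_dvd hn hdvd)))
    intro p hp
    obtain ⟨p', hp', rfl⟩ := Finset.mem_image.1 hp
    obtain ⟨y, z, -, rfl, hy, hz, e, hc⟩ := hmem p' hp'
    simp only [Nat.mul_div_cancel_left _ hg0]
    refine ⟨hy, hz, ?_, hc⟩
    rw [← e]; exact (Nat.mul_div_cancel_left _ (by positivity)).symm

/-! ### Critical points of the phase modulo a square-free number -/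

/-- The solutions in `ZMod d` of `x² + y² + z² + k = 0`, `2t(x, y, z) + (a, b, c) = 0`. -/
def critSystem (d : ℕ) [NeZero d] (k a b c : ℤ) :
    Finset (ZMod d × ZMod d × ZMod d × ZMod d) :=
  Finset.univ.filter fun v =>
    v.1 ^ 2 + v.2.1 ^ 2 + v.2.2.1 ^ 2 + (k : ZMod d) = 0 ∧ 2 * v.2.2.2 * v.1 + (a : ZMod d) = 0 ∧
      2 * v.2.2.2 * v.2.1 + (b : ZMod d) = 0 ∧ 2 * v.2.2.2 * v.2.2.1 + (c : ZMod d) = 0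

lemma mem_critSystem {d : ℕ} [NeZero d] {k a b c : ℤ} {v : ZMod d × ZMod d × ZMod d × ZMod d} :
    v ∈ critSystem d k a b c ↔
    v.1 ^ 2 + v.2.1 ^ 2 + v.2.2.1 ^ 2 + (k : ZMod d) = 0 ∧ 2 * v.2.2.2 * v.1 + (a : ZMod d) = 0 ∧
      2 * v.2.2.2 * v.2.1 + (b : ZMod d) = 0 ∧ 2 * v.2.2.2 * v.2.2.1 + (c : ZMod d) = 0 := by
  simp [critSystem]

lemma map_mem_critSystem {d e : ℕ} [NeZero d] [NeZero e] {k a b c : ℤ} (φ : ZMod d →+* ZMod e)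
    {v : ZMod d × ZMod d × ZMod d × ZMod d} (hv : v ∈ critSystem d k a b c) :
    (φ v.1, φ v.2.1, φ v.2.2.1, φ v.2.2.2) ∈ critSystem e k a b c := by
  rw [mem_critSystem] at hv ⊢
  obtain ⟨h1, h2, h3, h4⟩ := hv
  refine ⟨?_, ?_, ?_, ?_⟩
  · simpa using congrArg φ h1
  · simpa [map_ofNat φ 2] using congrArg φ h2
  · simpa [map_ofNat φ 2] using congrArg φ h3
  · simpa [map_ofNat φ 2] using congrArg φ h4

lemma card_critSystem_mul_le {m n : ℕ} [NeZero m] [NeZero n] (h : Nat.Coprime m n)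
    (k a b c : ℤ) :
    (critSystem (m * n) k a b c).card ≤
      (critSystem m k a b c).card * (critSystem n k a b c).card := by
  let e := ZMod.chineseRemainder h
  let φ : ZMod (m * n) →+* ZMod m := (RingHom.fst _ _).comp e.toRingHom
  let ψ : ZMod (m * n) →+* ZMod n := (RingHom.snd _ _).comp e.toRingHom
  have hinj : ∀ x y, φ x = φ y → ψ x = ψ y → x = y := fun x y h1 h2 =>
    e.injective (Prod.ext h1 h2)
  rw [← Finset.card_product]
  refine Finset.card_le_card_of_injOn (fun v => ((φ v.1, φ v.2.1, φ v.2.2.1, φ v.2.2.2),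
    (ψ v.1, ψ v.2.1, ψ v.2.2.1, ψ v.2.2.2))) ?_ ?_
  · intro v hv
    exact Finset.mem_coe.2 (Finset.mem_product.2
      ⟨map_mem_critSystem φ hv, map_mem_critSystem ψ hv⟩)
  · rintro ⟨x, y, z, t⟩ - ⟨x', y', z', t'⟩ - hv
    simp only [Prod.mk.injEq] at hv ⊢
    obtain ⟨⟨h1, h2, h3, h4⟩, g1, g2, g3, g4⟩ := hv
    exact ⟨hinj _ _ h1 g1, hinj _ _ h2 g2, hinj _ _ h3 g3, hinj _ _ h4 g4⟩

lemma card_filter_sq_eq_le_two {F : Type*} [Field F] [Fintype F] [DecidableEq F] (c : F) :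
    (Finset.univ.filter fun t : F => t ^ 2 = c).card ≤ 2 := by
  rcases (Finset.univ.filter fun t : F => t ^ 2 = c).eq_empty_or_nonempty with h | ⟨r, hr⟩
  · simp [h]
  · refine (Finset.card_le_card (t := {r, -r}) ?_).trans Finset.card_le_two
    intro t ht
    simp only [Finset.mem_filter, Finset.mem_univ, true_and, Finset.mem_insert,
      Finset.mem_singleton] at *
    exact sq_eq_sq_iff_eq_or_eq_neg.1 (ht.trans hr.symm)

lemma card_filter_sum_three_squares_le {p : ℕ} [Fact p.Prime] (k : ZMod p) :
    (Finset.univ.filter fun v : ZMod p × ZMod p × ZMod p =>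
      v.1 ^ 2 + v.2.1 ^ 2 + v.2.2 ^ 2 + k = 0).card ≤ 2 * p ^ 2 := by
  have hcard : (Finset.univ : Finset (ZMod p × ZMod p)).card = p ^ 2 := by
    simp [Finset.card_univ, ZMod.card, sq]
  rw [← hcard]
  refine Finset.card_le_mul_card_image_of_maps_to (f := fun v => (v.1, v.2.1))
    (fun _ _ => Finset.mem_univ _) 2 ?_
  rintro ⟨x, y⟩ -
  refine le_trans (Finset.card_le_card_of_injOn (fun v => v.2.2)
    (t := Finset.univ.filter fun t : ZMod p => t ^ 2 = -(x ^ 2 + y ^ 2 + k)) ?_ ?_)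
    (card_filter_sq_eq_le_two _)
  · rintro ⟨x', y', z'⟩ hv
    simp only [Finset.coe_filter, Finset.mem_filter, Finset.mem_univ, true_and, Set.mem_ofPred_eq,
      Prod.mk.injEq] at hv ⊢
    obtain ⟨h, rfl, rfl⟩ := hv
    linear_combination h
  · rintro ⟨x', y', z'⟩ hv ⟨x'', y'', z''⟩ hv' h
    simp only [Finset.coe_filter, Finset.mem_filter, Finset.mem_univ, true_and, Set.mem_ofPred_eq,
      Prod.mk.injEq] at hv hv' h ⊢
    obtain ⟨-, rfl, rfl⟩ := hv
    obtain ⟨-, rfl, rfl⟩ := hv'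
    exact ⟨rfl, rfl, h⟩

/-- At frequency zero `t (x, y, z) = 0`: either `t = 0` and the point lies on the quadric, at most
`2 p²` cases, or the point is the origin and `t` is free, at most `p` cases. -/
lemma card_critSystem_zero_le {p : ℕ} [Fact p.Prime] (hp2 : (2 : ZMod p) ≠ 0) {k a b c : ℤ}
    (ha : (a : ZMod p) = 0) (hb : (b : ZMod p) = 0) (hc : (c : ZMod p) = 0) :
    (critSystem p k a b c).card ≤ 3 * p ^ 2 := by
  have hsub : critSystem p k a b c ⊆
      ((Finset.univ.filter fun v : ZMod p × ZMod p × ZMod p =>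
        v.1 ^ 2 + v.2.1 ^ 2 + v.2.2 ^ 2 + (k : ZMod p) = 0).image
          fun v => (v.1, v.2.1, v.2.2, (0 : ZMod p))) ∪
      (Finset.univ : Finset (ZMod p)).image fun t => ((0 : ZMod p), (0 : ZMod p), (0 : ZMod p), t) := by
    rintro ⟨x, y, z, t⟩ hv
    rw [mem_critSystem] at hv
    simp only [ha, hb, hc, add_zero, mul_eq_zero, hp2, false_or] at hv
    obtain ⟨h0, h1, h2, h3⟩ := hv
    simp only [Finset.mem_union, Finset.mem_image, Finset.mem_filter, Finset.mem_univ, true_and,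
      Prod.mk.injEq, Prod.exists]
    by_cases ht : t = 0
    · exact Or.inl ⟨x, y, z, h0, rfl, rfl, rfl, ht.symm⟩
    · simp only [ht, false_or] at h1 h2 h3
      exact Or.inr ⟨t, h1.symm, h2.symm, h3.symm, rfl⟩
  refine (Finset.card_le_card hsub).trans ((Finset.card_union_le _ _).trans ?_)
  have h1 := Finset.card_image_le (s := Finset.univ.filter fun v : ZMod p × ZMod p × ZMod p =>
        v.1 ^ 2 + v.2.1 ^ 2 + v.2.2 ^ 2 + (k : ZMod p) = 0)
        (f := fun v => (v.1, v.2.1, v.2.2, (0 : ZMod p)))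
  have h2 := Finset.card_image_le (s := (Finset.univ : Finset (ZMod p)))
        (f := fun t => ((0 : ZMod p), (0 : ZMod p), (0 : ZMod p), t))
  have h3 := card_filter_sum_three_squares_le (k : ZMod p)
  rw [Finset.card_univ, ZMod.card] at h2
  have h4 : p ≤ p ^ 2 := Nat.le_self_pow two_ne_zero p
  omega

/-- Off the zero frequency the system is determined by `t`. -/
lemma injOn_critSystem {p : ℕ} [Fact p.Prime] (hp2 : (2 : ZMod p) ≠ 0) {k a b c : ℤ}
    (h : ¬((a : ZMod p) = 0 ∧ (b : ZMod p) = 0 ∧ (c : ZMod p) = 0)) :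
    Set.InjOn (fun v : ZMod p × ZMod p × ZMod p × ZMod p => v.2.2.2) (critSystem p k a b c) := by
  rintro ⟨x, y, z, t⟩ hv ⟨x', y', z', t'⟩ hv' ht
  rw [Finset.mem_coe, mem_critSystem] at hv hv'
  simp only at hv hv' ht
  subst ht
  obtain ⟨-, h1, h2, h3⟩ := hv
  obtain ⟨-, g1, g2, g3⟩ := hv'
  have ht0 : t ≠ 0 := by
    rintro rfl
    simp only [mul_zero, zero_mul, zero_add] at h1 h2 h3
    exact h ⟨h1, h2, h3⟩
  have ht2 : 2 * t ≠ 0 := mul_ne_zero hp2 ht0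
  have e1 : x = x' := mul_left_cancel₀ ht2 (by linear_combination h1 - g1)
  have e2 : y = y' := mul_left_cancel₀ ht2 (by linear_combination h2 - g2)
  have e3 : z = z' := mul_left_cancel₀ ht2 (by linear_combination h3 - g3)
  rw [e1, e2, e3]

/-- Multiplying the quadric equation by `4 t²` and eliminating `x, y, z` gives `4 k t² = -(a² + b² +
c²)`. As the right side is nonzero, so is `4 k`, and `t`, which determines the solution, has at most
two values. -/
lemma card_critSystem_le_two {p : ℕ} [Fact p.Prime] (hp2 : (2 : ZMod p) ≠ 0) {k a b c : ℤ}
    (h : (a : ZMod p) ^ 2 + (b : ZMod p) ^ 2 + (c : ZMod p) ^ 2 ≠ 0) :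
    (critSystem p k a b c).card ≤ 2 := by
  have hrel : ∀ v ∈ critSystem p k a b c, 4 * (k : ZMod p) * v.2.2.2 ^ 2 =
      -((a : ZMod p) ^ 2 + (b : ZMod p) ^ 2 + (c : ZMod p) ^ 2) := by
    rintro ⟨x, y, z, t⟩ hv
    rw [mem_critSystem] at hv
    obtain ⟨h0, h1, h2, h3⟩ := hv
    simp only at h0 h1 h2 h3 ⊢
    linear_combination 4 * t ^ 2 * h0 + (a - 2 * t * x) * h1 + (b - 2 * t * y) * h2 +
      (c - 2 * t * z) * h3
  refine le_trans (Finset.card_le_card_of_injOn (fun v => v.2.2.2)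
    (t := Finset.univ.filter fun t : ZMod p => t ^ 2 =
      -((a : ZMod p) ^ 2 + (b : ZMod p) ^ 2 + (c : ZMod p) ^ 2) / (4 * k)) ?_
      (injOn_critSystem hp2 fun h' => h (by simp [h'.1, h'.2.1, h'.2.2])))
    (card_filter_sq_eq_le_two _)
  intro v hv
  have := hrel v hv
  have hk : 4 * (k : ZMod p) ≠ 0 := by
    intro h0
    rw [h0, zero_mul] at this
    exact h (neg_eq_zero.1 this.symm)
  simp only [Finset.coe_filter, Finset.mem_univ, true_and, Set.mem_ofPred_eq]
  rw [eq_div_iff hk, ← this]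
  ring

/-- For odd `p` the bounds are `3 p²` at frequency zero (both gcds are `p`), `p` at a nonzero
isotropic frequency (the first gcd is `p`), and `2` otherwise. The constant is the trivial `2 ^ 4`
needed at `p = 2`; it equals `τ(p) ^ 4`. -/
lemma card_critSystem_prime_le {p : ℕ} [hp : Fact p.Prime] (k a b c : ℤ) :
    (critSystem p k a b c).card ≤ 16 * Nat.gcd p (a.natAbs ^ 2 + b.natAbs ^ 2 + c.natAbs ^ 2) *
      Nat.gcd p (Nat.gcd a.natAbs (Nat.gcd b.natAbs c.natAbs)) := by
  have hp0 : 0 < p := hp.out.pos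
  have hg1 : 1 ≤ Nat.gcd p (a.natAbs ^ 2 + b.natAbs ^ 2 + c.natAbs ^ 2) :=
    Nat.gcd_pos_of_pos_left _ hp0
  have hg2 : 1 ≤ Nat.gcd p (Nat.gcd a.natAbs (Nat.gcd b.natAbs c.natAbs)) :=
    Nat.gcd_pos_of_pos_left _ hp0
  have hzero : ∀ a : ℤ, (a : ZMod p) = 0 ↔ p ∣ a.natAbs := fun a => by
    rw [ZMod.intCast_zmod_eq_zero_iff_dvd, Int.natCast_dvd]
  have hsq : (a : ZMod p) ^ 2 + (b : ZMod p) ^ 2 + (c : ZMod p) ^ 2 = 0 ↔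
      p ∣ a.natAbs ^ 2 + b.natAbs ^ 2 + c.natAbs ^ 2 := by
    have := hzero (a ^ 2 + b ^ 2 + c ^ 2)
    push_cast at this
    rw [this, ← Int.natCast_dvd, ← Int.natCast_dvd_natCast]
    push_cast
    simp only [sq_abs]
  by_cases hp2 : (2 : ZMod p) = 0
  · have : p = 2 := by
      have : p ∣ 2 := by rw [← ZMod.natCast_eq_zero_iff]; exact_mod_cast hp2
      exact (Nat.prime_dvd_prime_iff_eq hp.out Nat.prime_two).1 this
    have h16 : (critSystem p k a b c).card ≤ 16 := by
      refine (Finset.card_le_univ _).trans ?_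
      simp only [Fintype.card_prod, ZMod.card, this]
      norm_num
    calc _ ≤ 16 * 1 * 1 := by omega
      _ ≤ _ := by gcongr
  by_cases h0 : (a : ZMod p) = 0 ∧ (b : ZMod p) = 0 ∧ (c : ZMod p) = 0
  · have e1 : Nat.gcd p (a.natAbs ^ 2 + b.natAbs ^ 2 + c.natAbs ^ 2) = p :=
      Nat.gcd_eq_left (hsq.1 (by simp [h0.1, h0.2.1, h0.2.2]))
    have e2 : Nat.gcd p (Nat.gcd a.natAbs (Nat.gcd b.natAbs c.natAbs)) = p :=
      Nat.gcd_eq_left (Nat.dvd_gcd ((hzero a).1 h0.1)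
        (Nat.dvd_gcd ((hzero b).1 h0.2.1) ((hzero c).1 h0.2.2)))
    rw [e1, e2]
    have := card_critSystem_zero_le (k := k) hp2 h0.1 h0.2.1 h0.2.2
    nlinarith
  by_cases hn : (a : ZMod p) ^ 2 + (b : ZMod p) ^ 2 + (c : ZMod p) ^ 2 = 0
  · have hle : (critSystem p k a b c).card ≤ p := by
      have := Finset.card_le_card_of_injOn (t := (Finset.univ : Finset (ZMod p)))
        (fun v : ZMod p × ZMod p × ZMod p × ZMod p => v.2.2.2) (fun _ _ => by simp)
        (injOn_critSystem (k := k) hp2 h0)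
      rwa [Finset.card_univ, ZMod.card] at this
    rw [Nat.gcd_eq_left (hsq.1 hn)]
    nlinarith
  · have := card_critSystem_le_two (k := k) hp2 hn
    calc _ ≤ 16 * 1 * 1 := by omega
      _ ≤ _ := by gcongr

/-- Submultiplicativity over the primes of `d`; the factors `16 = τ(p) ^ 4` multiply up to `τ(d) ^
4`, and the gcds are multiplicative in `d`. -/
theorem card_critSystem_le {d : ℕ} [hd : NeZero d] (hsf : Squarefree d) (k a b c : ℤ) :
    (critSystem d k a b c).card ≤ d.divisors.card ^ 4 *
      Nat.gcd d (a.natAbs ^ 2 + b.natAbs ^ 2 + c.natAbs ^ 2) *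
      Nat.gcd d (Nat.gcd a.natAbs (Nat.gcd b.natAbs c.natAbs)) := by
  revert hd hsf
  induction d using induction_on_primes with
  | zero =>
    intro hd _
    exact absurd rfl hd.out
  | one =>
    intro _ _
    refine (Finset.card_le_univ _).trans ?_
    simp
  | prime_mul p m hp ih =>
    intro hd hsf
    have hm0 : m ≠ 0 := by rintro rfl; exact hd.out (mul_zero _)
    have : NeZero m := ⟨hm0⟩
    have : Fact p.Prime := ⟨hp⟩
    have hcop : Nat.Coprime p m := Nat.coprime_of_squarefree_mul hsf
    have h1 := card_critSystem_mul_le hcop k a b c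
    have h2 := card_critSystem_prime_le (p := p) k a b c
    have h3 := ih (hsf.of_mul_right)
    have h4 : (p * m).divisors.card = 2 * m.divisors.card := by
      rw [Nat.Coprime.card_divisors_mul hcop, hp.divisors, Finset.card_pair hp.one_lt.ne]
    refine h1.trans ((Nat.mul_le_mul h2 h3).trans (le_of_eq ?_))
    rw [h4, Nat.gcd_comm (p * m), Nat.gcd_comm (p * m), hcop.gcd_mul, hcop.gcd_mul,
      Nat.gcd_comm p, Nat.gcd_comm m, Nat.gcd_comm p, Nat.gcd_comm m]
    ring

/-! ### Exponential sums and completion -/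

/-- The affine quadric `x² + y² + z² + k = 0` over `ZMod q`. -/
def quadric (q : ℕ) [NeZero q] (k : ℤ) : Finset (ZMod q × ZMod q × ZMod q) :=
  Finset.univ.filter fun v => v.1 ^ 2 + v.2.1 ^ 2 + v.2.2 ^ 2 + (k : ZMod q) = 0

/-- The exponential sum over the quadric at the frequency `(a, b, c)`. -/
noncomputable def quadricSum (q : ℕ) [NeZero q] (k : ℤ) (a b c : ZMod q) : ℂ :=
  ∑ v ∈ quadric q k, ZMod.stdAddChar (v.1 * a + v.2.1 * b + v.2.2 * c)

/-- The linear exponential sum over the interval `[1, N]`. -/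
noncomputable def linearSum (q : ℕ) [NeZero q] (N : ℕ) (a : ZMod q) : ℂ :=
  ∑ x ∈ Finset.Icc 1 N, ZMod.stdAddChar ((x : ZMod q) * a)

lemma sum_stdAddChar_mul (q : ℕ) [NeZero q] (b : ZMod q) :
    ∑ x : ZMod q, ZMod.stdAddChar (x * b) = if b = 0 then (q : ℂ) else 0 := by
  rw [AddChar.sum_mulShift b (ZMod.isPrimitive_stdAddChar q), ZMod.card]
  split_ifs <;> simp

lemma norm_linearSum_le (q : ℕ) [NeZero q] (N : ℕ) (a : ZMod q) : ‖linearSum q N a‖ ≤ N := by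
  refine (norm_sum_le _ _).trans ?_
  simp [AddChar.norm_apply]

/-- A geometric sum of ratio `w = e(j / q)` with `|j| ≤ q / 2`. Jordan's inequality for the sine
gives `|w - 1| = 2 |sin(π j / q)| ≥ 4 |j| / q`, so the bound holds with a factor 2 to spare. -/
lemma norm_linearSum_le_div (q : ℕ) [NeZero q] (N : ℕ) (a : ZMod q) (ha : a ≠ 0) :
    ‖linearSum q N a‖ ≤ q / a.valMinAbs.natAbs := by
  set j : ℤ := a.valMinAbs with hj
  have hj0 : j ≠ 0 := by rwa [hj, Ne, ZMod.valMinAbs_eq_zero]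
  have hq0 : (0 : ℝ) < q := by exact_mod_cast Nat.pos_of_ne_zero (NeZero.ne q)
  have hjpos : (0 : ℝ) < |(j : ℝ)| := abs_pos.2 (by exact_mod_cast hj0)
  have hjle : 2 * |(j : ℝ)| ≤ q := by
    have h1 := ZMod.natAbs_valMinAbs_le a
    have h2 : 2 * j.natAbs ≤ q := by omega
    have h3 : ((2 * j.natAbs : ℕ) : ℝ) ≤ q := by exact_mod_cast h2
    push_cast at h3
    rwa [Nat.cast_natAbs, Int.cast_abs] at h3
  set w : ℂ := ZMod.stdAddChar a with hw
  have hwn : ‖w‖ = 1 := AddChar.norm_apply _ _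
  have hsum : linearSum q N a = ∑ x ∈ Finset.Icc 1 N, w ^ x := by
    refine Finset.sum_congr rfl fun x _ => ?_
    rw [hw, ← AddChar.map_nsmul_eq_pow, nsmul_eq_mul]
  have hgeom : (w - 1) * linearSum q N a = w ^ (N + 1) - w := by
    rw [hsum]
    clear hsum
    induction N with
    | zero => simp
    | succ N ih =>
      rw [Finset.sum_Icc_succ_top (by omega), mul_add, ih]
      ring
  have hsub : 4 * |(j : ℝ)| / q ≤ ‖w - 1‖ := by
    have hwexp : w = Complex.exp (Complex.I * ((2 * Real.pi * j / q : ℝ) : ℂ)) := by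
      rw [hw, ← ZMod.coe_valMinAbs a, ZMod.stdAddChar_coe, ← hj]
      push_cast
      ring_nf
    rw [hwexp, Complex.norm_exp_I_mul_ofReal_sub_one]
    have habs : ‖2 * Real.sin (2 * Real.pi * j / q / 2)‖ = 2 * |Real.sin (Real.pi * |(j : ℝ)| / q)| := by
      rw [Real.norm_eq_abs, abs_mul, abs_two]
      congr 1
      rcases abs_choice (j : ℝ) with h | h <;> rw [h]
      · ring_nf
      · rw [mul_neg, neg_div, Real.sin_neg, abs_neg]
        ring_nf
    rw [habs]
    have hle : Real.pi * |(j : ℝ)| / q ≤ Real.pi / 2 := by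
      rw [div_le_div_iff₀ hq0 two_pos]
      nlinarith [Real.pi_pos]
    have := Real.mul_le_sin (x := Real.pi * |(j : ℝ)| / q) (by positivity) hle
    have h2 : 2 / Real.pi * (Real.pi * |(j : ℝ)| / q) = 2 * |(j : ℝ)| / q := by
      field_simp
    rw [h2] at this
    have h3 := le_abs_self (Real.sin (Real.pi * |(j : ℝ)| / q))
    calc 4 * |(j : ℝ)| / q = 2 * (2 * |(j : ℝ)| / q) := by ring
      _ ≤ _ := by linarith
  have hnum : ‖w ^ (N + 1) - w‖ ≤ 2 := by
    refine (norm_sub_le _ _).trans ?_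
    rw [norm_pow, hwn]; norm_num
  rw [← hgeom, norm_mul] at hnum
  rw [Nat.cast_natAbs, Int.cast_abs, le_div_iff₀ hjpos]
  have h5 : 4 * |(j : ℝ)| / q * ‖linearSum q N a‖ ≤ 2 :=
    (mul_le_mul_of_nonneg_right hsub (norm_nonneg _)).trans hnum
  have h6 : 4 * |(j : ℝ)| * ‖linearSum q N a‖ ≤ 2 * q := by
    have : 4 * |(j : ℝ)| / q * ‖linearSum q N a‖ = 4 * |(j : ℝ)| * ‖linearSum q N a‖ / q := by ring
    rw [this, div_le_iff₀ hq0] at h5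
    exact h5
  nlinarith

/-- The number of triples in `[1, N]³` whose reduction modulo `q` is on the quadric. -/
def boxCount (q N : ℕ) (k : ℤ) : ℕ :=
  ((Finset.Icc 1 N ×ˢ Finset.Icc 1 N ×ˢ Finset.Icc 1 N).filter
    fun t : ℕ × ℕ × ℕ =>
      (q : ℤ) ∣ (t.1 : ℤ) ^ 2 + (t.2.1 : ℤ) ^ 2 + (t.2.2 : ℤ) ^ 2 + k).card

lemma sum_stdAddChar_mul_linearSum (q : ℕ) [NeZero q] (N : ℕ) (r : ZMod q) :
    ∑ a : ZMod q, ZMod.stdAddChar (r * a) * linearSum q N (-a) =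
      q * ∑ x ∈ Finset.Icc 1 N, if (x : ZMod q) = r then (1 : ℂ) else 0 := by
  simp only [linearSum, Finset.mul_sum]
  rw [Finset.sum_comm]
  refine Finset.sum_congr rfl fun x _ => ?_
  have : ∀ a : ZMod q, (ZMod.stdAddChar (r * a) * ZMod.stdAddChar ((x : ZMod q) * -a) : ℂ) =
      ZMod.stdAddChar (a * (r - (x : ZMod q))) := fun a => by
    rw [← AddChar.map_add_eq_mul]; congr 1; ring
  simp only [this, sum_stdAddChar_mul, sub_eq_zero, mul_ite, mul_one, mul_zero, eq_comm (a := r)]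

lemma boxCount_eq_sum_quadric (q : ℕ) [NeZero q] (N : ℕ) (k : ℤ) :
    (boxCount q N k : ℂ) = ∑ v ∈ quadric q k,
      (∑ x ∈ Finset.Icc 1 N, if (x : ZMod q) = v.1 then (1 : ℂ) else 0) *
      ((∑ x ∈ Finset.Icc 1 N, if (x : ZMod q) = v.2.1 then (1 : ℂ) else 0) *
      (∑ x ∈ Finset.Icc 1 N, if (x : ZMod q) = v.2.2 then (1 : ℂ) else 0)) := by
  have hprod : ∀ f g h : ℕ → ℂ, (∑ x ∈ Finset.Icc 1 N, f x) * ((∑ x ∈ Finset.Icc 1 N, g x) *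
      ∑ x ∈ Finset.Icc 1 N, h x) =
      ∑ t ∈ Finset.Icc 1 N ×ˢ Finset.Icc 1 N ×ˢ Finset.Icc 1 N, f t.1 * (g t.2.1 * h t.2.2) := by
    intro f g h
    rw [Finset.sum_mul_sum, ← Finset.sum_product', Finset.sum_mul_sum, ← Finset.sum_product']
  simp only [hprod, boxCount]
  rw [Finset.sum_comm, Finset.card_filter]
  push_cast
  refine Finset.sum_congr rfl fun t _ => ?_
  have hiff : (q : ℤ) ∣ (t.1 : ℤ) ^ 2 + (t.2.1 : ℤ) ^ 2 + (t.2.2 : ℤ) ^ 2 + k ↔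
      (((t.1 : ZMod q), (t.2.1 : ZMod q), (t.2.2 : ZMod q)) : ZMod q × ZMod q × ZMod q)
        ∈ quadric q k := by
    rw [← ZMod.intCast_zmod_eq_zero_iff_dvd]
    simp [quadric]
  rw [if_congr hiff rfl rfl, ← Finset.sum_ite_eq' (quadric q k) _ (fun _ => (1 : ℂ))]
  refine Finset.sum_congr rfl fun v _ => ?_
  obtain ⟨v₁, v₂, v₃⟩ := v
  simp only [ite_zero_mul_ite_zero, mul_one, Prod.mk.injEq]
  exact if_congr (by rw [eq_comm, eq_comm (b := v₂), eq_comm (b := v₃)]) rfl rfl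

/-- Completion: the box count in terms of complete exponential sums. -/
theorem boxCount_completion (q : ℕ) [NeZero q] (N : ℕ) (k : ℤ) :
    (q : ℂ) ^ 3 * boxCount q N k = ∑ u : ZMod q × ZMod q × ZMod q,
      quadricSum q k u.1 u.2.1 u.2.2 *
        (linearSum q N (-u.1) * (linearSum q N (-u.2.1) * linearSum q N (-u.2.2))) := by
  simp only [quadricSum, Finset.sum_mul]
  rw [Finset.sum_comm, boxCount_eq_sum_quadric, Finset.mul_sum]
  refine Finset.sum_congr rfl fun v _ => ?_
  have h : ∀ A B C : ℂ, (q : ℂ) ^ 3 * (A * (B * C)) = (q * A) * ((q * B) * (q * C)) :=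
    fun A B C => by ring
  rw [h, ← sum_stdAddChar_mul_linearSum, ← sum_stdAddChar_mul_linearSum,
    ← sum_stdAddChar_mul_linearSum]
  rw [Finset.sum_mul_sum, ← Finset.sum_product', Finset.sum_mul_sum, ← Finset.sum_product']
  simp only [Finset.univ_product_univ]
  refine Finset.sum_congr rfl fun u _ => ?_
  rw [AddChar.map_add_eq_mul, AddChar.map_add_eq_mul]
  ring

/-! ### Stationary phase modulo `d ^ 2` -/

lemma card_castHom_fiber_le {d : ℕ} [NeZero d] (r : ZMod d) :
    (Finset.univ.filter fun x : ZMod (d ^ 2) =>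
      ZMod.castHom (dvd_pow_self d two_ne_zero) (ZMod d) x = r).card ≤ d := by
  have hd0 : 0 < d := Nat.pos_of_ne_zero (NeZero.ne d)
  have hval : ∀ x : ZMod (d ^ 2), ZMod.castHom (dvd_pow_self d two_ne_zero) (ZMod d) x = r →
      x.val % d = r.val := by
    intro x hx
    rw [← hx, ZMod.castHom_apply, ZMod.cast_eq_val, ZMod.val_natCast]
  conv_rhs => rw [← Finset.card_range d]
  refine Finset.card_le_card_of_injOn (fun x => x.val / d) ?_ ?_
  · intro x _
    have : x.val < d * d := (ZMod.val_lt x).trans_eq (sq d)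
    simpa using Nat.div_lt_of_lt_mul this
  · intro x hx y hy h
    have h1 := hval x (Finset.mem_filter.1 hx).2
    have h2 := hval y (Finset.mem_filter.1 hy).2
    simp only at h
    apply ZMod.val_injective
    rw [← Nat.div_add_mod x.val d, ← Nat.div_add_mod y.val d, h1, h2, h]

lemma castHom_eq_zero_of_mul_eq_zero {d : ℕ} [NeZero d] {x : ZMod (d ^ 2)}
    (h : (d : ZMod (d ^ 2)) * x = 0) :
    ZMod.castHom (dvd_pow_self d two_ne_zero) (ZMod d) x = 0 := by
  have hd0 : 0 < d := Nat.pos_of_ne_zero (NeZero.ne d)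
  rw [← ZMod.natCast_zmod_val x, ← Nat.cast_mul, ZMod.natCast_eq_zero_iff] at h
  rw [ZMod.castHom_apply, ZMod.cast_eq_val, ZMod.natCast_eq_zero_iff]
  exact Nat.dvd_of_mul_dvd_mul_left hd0 ((sq d).symm.dvd.trans h)

/-- Averaging over translates: the sum is unchanged under `g ↦ g + σ h`, so summing over `h` gives
`|G| ∑ f = ∑ f(g) ∑ χ(g, h)`. Only `g ∈ s` survive, each contributing at most `|G|`. -/
lemma norm_sum_le_card_of_shift {G : Type*} [AddCommGroup G] [Fintype G]
    (f : G → ℂ) (hf : ∀ g, ‖f g‖ = 1) (σ : G → G) (χ : G → G → ℂ) (hχ : ∀ g h, ‖χ g h‖ = 1)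
    (hshift : ∀ g h, f (g + σ h) = f g * χ g h) (s : Finset G)
    (hs : ∀ g ∉ s, ∑ h, χ g h = 0) : ‖∑ g, f g‖ ≤ s.card := by
  have hG : (0 : ℝ) < Fintype.card G := by
    have : Nonempty G := ⟨0⟩
    exact_mod_cast Fintype.card_pos
  have h1 : (Fintype.card G : ℂ) * ∑ g, f g = ∑ g ∈ s, f g * ∑ h, χ g h := by
    calc (Fintype.card G : ℂ) * ∑ g, f g = ∑ h : G, ∑ g, f (g + σ h) := by
          have (h : G) : ∑ g, f (g + σ h) = ∑ g, f g :=
            Fintype.sum_equiv (Equiv.addRight (σ h)) _ _ fun _ => rfl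
          simp [this]
      _ = ∑ g, f g * ∑ h, χ g h := by
          rw [Finset.sum_comm]
          simp only [hshift, Finset.mul_sum]
      _ = _ := by
          symm
          refine Finset.sum_subset (Finset.subset_univ s) fun g _ hg => ?_
          rw [hs g hg, mul_zero]
  have h2 : (Fintype.card G : ℝ) * ‖∑ g, f g‖ ≤ Fintype.card G * s.card := by
    calc (Fintype.card G : ℝ) * ‖∑ g, f g‖ = ‖(Fintype.card G : ℂ) * ∑ g, f g‖ := by simp
      _ ≤ ∑ g ∈ s, ‖f g * ∑ h, χ g h‖ := by rw [h1]; exact norm_sum_le _ _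
      _ ≤ ∑ g ∈ s, (Fintype.card G : ℝ) := by
          refine Finset.sum_le_sum fun g _ => ?_
          rw [norm_mul, hf, one_mul]
          refine (norm_sum_le _ _).trans ?_
          simp [hχ]
      _ = _ := by simp [mul_comm]
  exact le_of_mul_le_mul_left h2 hG

/-- The critical frequencies for the shifts by multiples of `d` modulo `d ^ 2`. -/
lemma card_filter_mul_eq_zero_le {d : ℕ} [NeZero d] (k a b c : ℤ) :
    (Finset.univ.filter fun g : ZMod (d ^ 2) × ZMod (d ^ 2) × ZMod (d ^ 2) × ZMod (d ^ 2) =>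
      (d : ZMod (d ^ 2)) * (g.1 ^ 2 + g.2.1 ^ 2 + g.2.2.1 ^ 2 + (k : ZMod (d ^ 2))) = 0 ∧
      (d : ZMod (d ^ 2)) * (2 * g.2.2.2 * g.1 + (a : ZMod (d ^ 2))) = 0 ∧
      (d : ZMod (d ^ 2)) * (2 * g.2.2.2 * g.2.1 + (b : ZMod (d ^ 2))) = 0 ∧
      (d : ZMod (d ^ 2)) * (2 * g.2.2.2 * g.2.2.1 + (c : ZMod (d ^ 2))) = 0).card ≤
      d ^ 4 * (critSystem d k a b c).card := by
  set φ := ZMod.castHom (dvd_pow_self d two_ne_zero) (ZMod d) with hφ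
  refine Finset.card_le_mul_card_image_of_maps_to
    (f := fun g => (φ g.1, φ g.2.1, φ g.2.2.1, φ g.2.2.2)) ?_ _ ?_
  · rintro ⟨x, y, z, t⟩ hg
    obtain ⟨h0, h1, h2, h3⟩ := (Finset.mem_filter.1 hg).2
    rw [mem_critSystem]
    refine ⟨?_, ?_, ?_, ?_⟩
    · simpa only [map_add, map_mul, map_pow, map_intCast, map_ofNat] using
        castHom_eq_zero_of_mul_eq_zero h0
    · simpa only [map_add, map_mul, map_pow, map_intCast, map_ofNat] using
        castHom_eq_zero_of_mul_eq_zero h1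
    · simpa only [map_add, map_mul, map_pow, map_intCast, map_ofNat] using
        castHom_eq_zero_of_mul_eq_zero h2
    · simpa only [map_add, map_mul, map_pow, map_intCast, map_ofNat] using
        castHom_eq_zero_of_mul_eq_zero h3
  · rintro ⟨x, y, z, t⟩ -
    let T := fun r : ZMod d => Finset.univ.filter fun x : ZMod (d ^ 2) => φ x = r
    have hT : ∀ r, (T r).card ≤ d := card_castHom_fiber_le
    calc _ ≤ (T x ×ˢ T y ×ˢ T z ×ˢ T t).card := by
          refine Finset.card_le_card ?_
          rintro ⟨x', y', z', t'⟩ hg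
          have := (Finset.mem_filter.1 hg).2
          simp only [Prod.mk.injEq] at this
          simp [T, this]
      _ = (T x).card * ((T y).card * ((T z).card * (T t).card)) := by
          simp only [Finset.card_product]
      _ ≤ d * (d * (d * d)) := by
          gcongr <;> exact hT _
      _ = d ^ 4 := by ring

/-- With a dual variable `t` detecting the quadric, `d²` times the sum becomes a complete sum over
`(x, y, z, t)`. A shift by `d h` changes the phase linearly in `h` because `d² = 0`, and the
coefficients are `d` times the gradient. The survivors are the at most `d⁴` lifts of each critical
point modulo `d`; dividing by `d²` gives the bound. -/
theorem norm_quadricSum_le {d : ℕ} [NeZero d] (k a b c : ℤ) :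
    ‖quadricSum (d ^ 2) k (a : ZMod (d ^ 2)) b c‖ ≤ d ^ 2 * (critSystem d k a b c).card := by
  have hd0 : (0 : ℝ) < d := by exact_mod_cast Nat.pos_of_ne_zero (NeZero.ne d)
  have hdd : (d : ZMod (d ^ 2)) * d = 0 := by
    have := ZMod.natCast_self (d ^ 2)
    rw [Nat.cast_pow] at this
    rw [← this]; ring
  set ψ : AddChar (ZMod (d ^ 2)) ℂ := ZMod.stdAddChar with hψ
  let F : ZMod (d ^ 2) → ZMod (d ^ 2) → ZMod (d ^ 2) → ZMod (d ^ 2) :=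
    fun x y z => x ^ 2 + y ^ 2 + z ^ 2 + (k : ZMod (d ^ 2))
  let f : ZMod (d ^ 2) × ZMod (d ^ 2) × ZMod (d ^ 2) × ZMod (d ^ 2) → ℂ := fun g =>
    ψ (g.2.2.2 * F g.1 g.2.1 g.2.2.1 + (g.1 * a + g.2.1 * b + g.2.2.1 * c))
  have hf : ∑ g, f g = ((d ^ 2 : ℕ) : ℂ) * quadricSum (d ^ 2) k (a : ZMod (d ^ 2)) b c := by
    simp only [quadricSum, quadric, Finset.sum_filter, Finset.mul_sum, Fintype.sum_prod_type, f]
    refine Finset.sum_congr rfl fun x _ => Finset.sum_congr rfl fun y _ =>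
      Finset.sum_congr rfl fun z _ => ?_
    simp only [AddChar.map_add_eq_mul]
    rw [← Finset.sum_mul, hψ, sum_stdAddChar_mul]
    simp only [F]
    split_ifs <;> simp
  let χ : ZMod (d ^ 2) × ZMod (d ^ 2) × ZMod (d ^ 2) × ZMod (d ^ 2) →
      ZMod (d ^ 2) × ZMod (d ^ 2) × ZMod (d ^ 2) × ZMod (d ^ 2) → ℂ := fun g h =>
    ψ (h.1 * (d * (2 * g.2.2.2 * g.1 + a))) * (ψ (h.2.1 * (d * (2 * g.2.2.2 * g.2.1 + b))) *
      (ψ (h.2.2.1 * (d * (2 * g.2.2.2 * g.2.2.1 + c))) *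
        ψ (h.2.2.2 * (d * F g.1 g.2.1 g.2.2.1))))
  have hχsum : ∀ g, ∑ h, χ g h =
      (∑ v, ψ (v * (d * (2 * g.2.2.2 * g.1 + a)))) *
      ((∑ v, ψ (v * (d * (2 * g.2.2.2 * g.2.1 + b)))) *
      ((∑ v, ψ (v * (d * (2 * g.2.2.2 * g.2.2.1 + c)))) *
        ∑ v, ψ (v * (d * F g.1 g.2.1 g.2.2.1)))) := by
    intro g
    rw [Finset.sum_mul_sum, ← Finset.sum_product', Finset.sum_mul_sum, ← Finset.sum_product',
      Finset.sum_mul_sum, ← Finset.sum_product']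
    rfl
  have key := norm_sum_le_card_of_shift f (fun g => AddChar.norm_apply _ _)
    (fun h => (d * h.1, d * h.2.1, d * h.2.2.1, d * h.2.2.2)) χ
    (fun g h => by simp only [χ, norm_mul, AddChar.norm_apply, mul_one]) ?_
    (Finset.univ.filter fun g =>
      (d : ZMod (d ^ 2)) * (g.1 ^ 2 + g.2.1 ^ 2 + g.2.2.1 ^ 2 + (k : ZMod (d ^ 2))) = 0 ∧
      (d : ZMod (d ^ 2)) * (2 * g.2.2.2 * g.1 + (a : ZMod (d ^ 2))) = 0 ∧
      (d : ZMod (d ^ 2)) * (2 * g.2.2.2 * g.2.1 + (b : ZMod (d ^ 2))) = 0 ∧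
      (d : ZMod (d ^ 2)) * (2 * g.2.2.2 * g.2.2.1 + (c : ZMod (d ^ 2))) = 0) ?_
  · rw [hf, norm_mul, Complex.norm_natCast] at key
    have hc : ((Finset.card (Finset.univ.filter
      fun g : ZMod (d ^ 2) × ZMod (d ^ 2) × ZMod (d ^ 2) × ZMod (d ^ 2) =>
      (d : ZMod (d ^ 2)) * (g.1 ^ 2 + g.2.1 ^ 2 + g.2.2.1 ^ 2 + (k : ZMod (d ^ 2))) = 0 ∧
      (d : ZMod (d ^ 2)) * (2 * g.2.2.2 * g.1 + (a : ZMod (d ^ 2))) = 0 ∧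
      (d : ZMod (d ^ 2)) * (2 * g.2.2.2 * g.2.1 + (b : ZMod (d ^ 2))) = 0 ∧
      (d : ZMod (d ^ 2)) * (2 * g.2.2.2 * g.2.2.1 + (c : ZMod (d ^ 2))) = 0) : ℕ) : ℝ) ≤
      d ^ 4 * (critSystem d k a b c).card := by
      exact_mod_cast card_filter_mul_eq_zero_le k a b c
    have h2 := key.trans hc
    push_cast at h2
    have h3 : (d : ℝ) ^ 4 * (critSystem d k a b c).card =
        d ^ 2 * (d ^ 2 * (critSystem d k a b c).card) := by ring
    rw [h3] at h2
    exact le_of_mul_le_mul_left h2 (by positivity)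
  · rintro ⟨x, y, z, t⟩ ⟨x', y', z', t'⟩
    simp only [f, χ, F, Prod.mk_add_mk, ← AddChar.map_add_eq_mul]
    congr 1
    -- All terms of order at least two in the shift carry a factor `d * d = 0`.
    linear_combination (t * (x' ^ 2 + y' ^ 2 + z' ^ 2) + t' * (2 * (x * x' + y * y' + z * z')) +
      d * t' * (x' ^ 2 + y' ^ 2 + z' ^ 2)) * hdd
  · intro g hg
    rw [hχsum]
    simp only [hψ, sum_stdAddChar_mul]
    simp only [Finset.mem_filter, Finset.mem_univ, true_and, not_and_or] at hg
    rcases hg with h | h | h | h <;> simp [F, h]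

/-! ### Averaging the error over the moduli -/

/-- Upper bound for the linear exponential sum modulo `d ^ 2` over `[1, N]` at frequency `i`. -/
noncomputable def freqWeight (d N i : ℕ) : ℝ := if i = 0 then (N : ℝ) else (d : ℝ) ^ 2 / i

lemma freqWeight_nonneg (d N i : ℕ) : 0 ≤ freqWeight d N i := by
  unfold freqWeight; split_ifs <;> positivity

/-- Upper bound for the contribution of the frequency `(i, j, l)`, up to divisor functions. -/
noncomputable def tripleWeight (d N i j l : ℕ) : ℝ :=
  Nat.gcd d (i ^ 2 + j ^ 2 + l ^ 2) * Nat.gcd d (Nat.gcd i (Nat.gcd j l)) *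
    (freqWeight d N i * (freqWeight d N j * freqWeight d N l))

lemma tripleWeight_nonneg (d N i j l : ℕ) : 0 ≤ tripleWeight d N i j l := by
  have := freqWeight_nonneg d N
  unfold tripleWeight
  have := mul_nonneg (this i) (mul_nonneg (this j) (this l))
  positivity

lemma tripleWeight_swap (d N i j l : ℕ) : tripleWeight d N i j l = tripleWeight d N j i l := by
  unfold tripleWeight
  rw [add_comm (i ^ 2), Nat.gcd_left_comm i j l]
  ring

lemma tripleWeight_swap' (d N i j l : ℕ) : tripleWeight d N i j l = tripleWeight d N i l j := by
  unfold tripleWeight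
  rw [add_right_comm (i ^ 2), Nat.gcd_comm j l]
  ring

lemma natCast_gcd_gcd_le (d l : ℕ) {i j : ℕ} (hi : 0 < i) :
    (Nat.gcd d (Nat.gcd i (Nat.gcd j l)) : ℝ) ≤ Nat.gcd i j := by
  have : Nat.gcd d (Nat.gcd i (Nat.gcd j l)) ∣ Nat.gcd i j :=
    Nat.dvd_gcd ((Nat.gcd_dvd_right _ _).trans (Nat.gcd_dvd_left _ _))
      ((Nat.gcd_dvd_right _ _).trans ((Nat.gcd_dvd_right _ _).trans (Nat.gcd_dvd_left _ _)))
  exact_mod_cast Nat.le_of_dvd (Nat.gcd_pos_of_pos_left _ hi) this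

/-- The weights give `d⁶ / (i j l)`, which leaves `d² ≤ D²` after division by `d⁴`. The second gcd
is replaced by `gcd(i, j)`, free of `d`, so that only the first is averaged, by `sum_gcd_le`. -/
lemma sum_tripleWeight_le_of_pos (D N : ℕ) {i j l : ℕ} (hi : 0 < i) (hj : 0 < j) (hl : 0 < l)
    {K : ℝ} (hK : ((i ^ 2 + j ^ 2 + l ^ 2).divisors.card : ℝ) ≤ K) :
    ∑ d ∈ Finset.Icc 1 D, tripleWeight d N i j l / (d : ℝ) ^ 4 ≤
      K * D ^ 3 * ((Nat.gcd i j : ℝ) / (i * j) * (1 / l)) := by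
  have hn : i ^ 2 + j ^ 2 + l ^ 2 ≠ 0 := by positivity
  calc ∑ d ∈ Finset.Icc 1 D, tripleWeight d N i j l / (d : ℝ) ^ 4
      ≤ ∑ d ∈ Finset.Icc 1 D, (D : ℝ) ^ 2 * ((Nat.gcd i j : ℝ) / (i * j) * (1 / l)) *
          (Nat.gcd d (i ^ 2 + j ^ 2 + l ^ 2) : ℝ) := by
        refine Finset.sum_le_sum fun d hd => ?_
        obtain ⟨hd1, hd2⟩ := Finset.mem_Icc.1 hd
        have hd0 : (0 : ℝ) < d := by exact_mod_cast hd1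
        have hdD : (d : ℝ) ≤ D := by exact_mod_cast hd2
        unfold tripleWeight freqWeight
        rw [if_neg hi.ne', if_neg hj.ne', if_neg hl.ne']
        have e : (Nat.gcd d (i ^ 2 + j ^ 2 + l ^ 2) : ℝ) *
            Nat.gcd d (Nat.gcd i (Nat.gcd j l)) *
            ((d : ℝ) ^ 2 / i * ((d : ℝ) ^ 2 / j * ((d : ℝ) ^ 2 / l))) / (d : ℝ) ^ 4 =
            (d : ℝ) ^ 2 * ((Nat.gcd d (Nat.gcd i (Nat.gcd j l)) : ℝ) / (i * j) * (1 / l)) *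
            Nat.gcd d (i ^ 2 + j ^ 2 + l ^ 2) := by
          field_simp
        rw [e]
        have := natCast_gcd_gcd_le d l (j := j) hi
        gcongr
    _ ≤ (D : ℝ) ^ 2 * ((Nat.gcd i j : ℝ) / (i * j) * (1 / l)) * (D * K) := by
        rw [← Finset.mul_sum]
        have := (sum_gcd_le D _ hn).trans (mul_le_mul_of_nonneg_left hK (Nat.cast_nonneg D))
        gcongr
    _ = _ := by ring

/-- Now the powers of `d` cancel exactly, and the average of the first gcd supplies the single
factor `D`. -/
lemma sum_tripleWeight_le_of_zero (D N : ℕ) {i j : ℕ} (hi : 0 < i) (hj : 0 < j)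
    {K : ℝ} (hK : ((i ^ 2 + j ^ 2 + 0 ^ 2).divisors.card : ℝ) ≤ K) :
    ∑ d ∈ Finset.Icc 1 D, tripleWeight d N i j 0 / (d : ℝ) ^ 4 ≤
      K * (N * D) * ((Nat.gcd i j : ℝ) / (i * j)) := by
  have hn : i ^ 2 + j ^ 2 + 0 ^ 2 ≠ 0 := by positivity
  calc ∑ d ∈ Finset.Icc 1 D, tripleWeight d N i j 0 / (d : ℝ) ^ 4
      ≤ ∑ d ∈ Finset.Icc 1 D, (N : ℝ) * ((Nat.gcd i j : ℝ) / (i * j)) *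
          (Nat.gcd d (i ^ 2 + j ^ 2 + 0 ^ 2) : ℝ) := by
        refine Finset.sum_le_sum fun d hd => ?_
        obtain ⟨hd1, hd2⟩ := Finset.mem_Icc.1 hd
        have hd0 : (0 : ℝ) < d := by exact_mod_cast hd1
        unfold tripleWeight freqWeight
        rw [if_neg hi.ne', if_neg hj.ne', if_pos rfl]
        have e : (Nat.gcd d (i ^ 2 + j ^ 2 + 0 ^ 2) : ℝ) *
            Nat.gcd d (Nat.gcd i (Nat.gcd j 0)) *
            ((d : ℝ) ^ 2 / i * ((d : ℝ) ^ 2 / j * N)) / (d : ℝ) ^ 4 =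
            N * ((Nat.gcd d (Nat.gcd i (Nat.gcd j 0)) : ℝ) / (i * j)) *
            Nat.gcd d (i ^ 2 + j ^ 2 + 0 ^ 2) := by
          field_simp
        rw [e]
        have := natCast_gcd_gcd_le d 0 (j := j) hi
        gcongr
    _ ≤ (N : ℝ) * ((Nat.gcd i j : ℝ) / (i * j)) * (D * K) := by
        rw [← Finset.mul_sum]
        have := (sum_gcd_le D _ hn).trans (mul_le_mul_of_nonneg_left hK (Nat.cast_nonneg D))
        gcongr
    _ = _ := by ring

/-- Here the first gcd is bounded trivially by `d`. What remains has the shape of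
`sum_gcd_div_mul_le`, so summing over `d` and `i` together costs only logarithms. -/
lemma sum_tripleWeight_le_of_zero_zero (D N : ℕ) {i : ℕ} (hi : 0 < i) :
    ∑ d ∈ Finset.Icc 1 D, tripleWeight d N i 0 0 / (d : ℝ) ^ 4 ≤
      N ^ 2 * ∑ d ∈ Finset.Icc 1 D, (Nat.gcd d i : ℝ) / (d * i) := by
  rw [Finset.mul_sum]
  refine Finset.sum_le_sum fun d hd => ?_
  obtain ⟨hd1, hd2⟩ := Finset.mem_Icc.1 hd
  have hd0 : (0 : ℝ) < d := by exact_mod_cast hd1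
  unfold tripleWeight freqWeight
  rw [if_neg hi.ne', if_pos rfl, Nat.gcd_zero_right, Nat.gcd_zero_right]
  have h : (Nat.gcd d (i ^ 2 + 0 ^ 2 + 0 ^ 2) : ℝ) ≤ d := by
    exact_mod_cast Nat.gcd_le_left _ hd1
  have e : (Nat.gcd d (i ^ 2 + 0 ^ 2 + 0 ^ 2) : ℝ) * Nat.gcd d i *
      ((d : ℝ) ^ 2 / i * (N * N)) / (d : ℝ) ^ 4 =
      N ^ 2 * (Nat.gcd d i / (d ^ 2 * i)) * Nat.gcd d (i ^ 2 + 0 ^ 2 + 0 ^ 2) := by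
    field_simp
  rw [e]
  calc _ ≤ (N : ℝ) ^ 2 * (Nat.gcd d i / (d ^ 2 * i)) * d := by gcongr
    _ = _ := by field_simp

/-- Bound for a nonzero frequency; terms with a vanishing denominator are zero. -/
noncomputable def freqMajorant (D N : ℕ) (K : ℝ) (i j l : ℕ) : ℝ :=
  K * D ^ 3 * ((Nat.gcd i j : ℝ) / (i * j) * (1 / l)) +
  K * (N * D) * ((if l = 0 then (Nat.gcd i j : ℝ) / (i * j) else 0) +
    (if j = 0 then (Nat.gcd i l : ℝ) / (i * l) else 0) +
    (if i = 0 then (Nat.gcd j l : ℝ) / (j * l) else 0)) +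
  N ^ 2 * ((if j = 0 then if l = 0 then ∑ d ∈ Finset.Icc 1 D, (Nat.gcd d i : ℝ) / (d * i) else 0
      else 0) +
    (if i = 0 then if l = 0 then ∑ d ∈ Finset.Icc 1 D, (Nat.gcd d j : ℝ) / (d * j) else 0 else 0) +
    (if i = 0 then if j = 0 then ∑ d ∈ Finset.Icc 1 D, (Nat.gcd d l : ℝ) / (d * l) else 0 else 0))

lemma sum_tripleWeight_le_freqMajorant (D N : ℕ) {i j l : ℕ} (h : ¬(i = 0 ∧ j = 0 ∧ l = 0))
    {K : ℝ} (hK : ((i ^ 2 + j ^ 2 + l ^ 2).divisors.card : ℝ) ≤ K) :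
    ∑ d ∈ Finset.Icc 1 D, tripleWeight d N i j l / (d : ℝ) ^ 4 ≤ freqMajorant D N K i j l := by
  unfold freqMajorant
  rcases Nat.eq_zero_or_pos i with rfl | hi <;> rcases Nat.eq_zero_or_pos j with rfl | hj <;>
    rcases Nat.eq_zero_or_pos l with rfl | hl
  · simp at h
  · simp_rw [fun d => tripleWeight_swap' d N 0 0 l, fun d => tripleWeight_swap d N 0 l 0]
    refine (sum_tripleWeight_le_of_zero_zero D N hl).trans (le_of_eq ?_)
    simp [hl.ne']
  · simp_rw [fun d => tripleWeight_swap d N 0 j 0]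
    refine (sum_tripleWeight_le_of_zero_zero D N hj).trans (le_of_eq ?_)
    simp [hj.ne']
  · simp_rw [fun d => tripleWeight_swap d N 0 j l, fun d => tripleWeight_swap' d N j 0 l]
    refine (sum_tripleWeight_le_of_zero D N hj hl (K := K) ?_).trans (le_of_eq ?_)
    · convert hK using 4; ring
    · simp [hl.ne', hj.ne']
  · refine (sum_tripleWeight_le_of_zero_zero D N hi).trans (le_of_eq ?_)
    simp [hi.ne']
  · simp_rw [fun d => tripleWeight_swap' d N i 0 l]
    refine (sum_tripleWeight_le_of_zero D N hi hl (K := K) ?_).trans (le_of_eq ?_)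
    · convert hK using 4; ring
    · simp [hl.ne', hi.ne']
  · refine (sum_tripleWeight_le_of_zero D N hi hj hK).trans (le_of_eq ?_)
    simp [hj.ne', hi.ne']
  · refine (sum_tripleWeight_le_of_pos D N hi hj hl hK).trans (le_of_eq ?_)
    simp [hj.ne', hi.ne', hl.ne']

lemma sum_range_eq_sum_Icc {f : ℕ → ℝ} (hf : f 0 = 0) (Q : ℕ) :
    ∑ i ∈ Finset.range (Q + 1), f i = ∑ i ∈ Finset.Icc 1 Q, f i := by
  rw [Finset.sum_range_succ', hf, add_zero, Finset.range_eq_Ico,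
    Finset.sum_Ico_add' f 0 Q 1, zero_add]
  rfl

/-- Each double sum of gcds costs `h ^ 3`, and a third free frequency costs one more `h`. The
factors 3 count the positions of the zero coordinates. -/
lemma sum_freqMajorant_le (D N Q : ℕ) (hDQ : D ≤ Q) {K : ℝ} (hK0 : 0 ≤ K) {h : ℝ}
    (hh : ∑ i ∈ Finset.Icc 1 Q, (1 : ℝ) / i ≤ h) :
    ∑ i ∈ Finset.range (Q + 1), ∑ j ∈ Finset.range (Q + 1), ∑ l ∈ Finset.range (Q + 1),
      freqMajorant D N K i j l ≤
      K * D ^ 3 * h ^ 4 + 3 * (K * (N * D) * h ^ 3) + 3 * (N ^ 2 * h ^ 3) := by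
  have hh0 : 0 ≤ ∑ i ∈ Finset.Icc 1 Q, (1 : ℝ) / i := Finset.sum_nonneg fun _ _ => by positivity
  have hGle : ∑ i ∈ Finset.range (Q + 1), ∑ j ∈ Finset.range (Q + 1), (Nat.gcd i j : ℝ) / (i * j) ≤
      h ^ 3 := by
    rw [sum_range_eq_sum_Icc (by simp)]
    simp_rw [fun i : ℕ => sum_range_eq_sum_Icc (f := fun j => (Nat.gcd i j : ℝ) / (i * j)) (by simp) Q]
    refine (sum_gcd_div_mul_le Q Q).trans ?_
    calc _ ≤ h ^ 2 * h := by gcongr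
      _ = _ := by ring
  have hHle : ∑ l ∈ Finset.range (Q + 1), (1 : ℝ) / l ≤ h := by
    rwa [sum_range_eq_sum_Icc (by simp)]
  have hPle : ∑ i ∈ Finset.range (Q + 1), ∑ d ∈ Finset.Icc 1 D, (Nat.gcd d i : ℝ) / (d * i) ≤
      h ^ 3 := by
    rw [sum_range_eq_sum_Icc (by simp), Finset.sum_comm]
    refine (sum_gcd_div_mul_le D Q).trans ?_
    have : ∑ i ∈ Finset.Icc 1 D, (1 : ℝ) / i ≤ h :=
      (Finset.sum_le_sum_of_subset_of_nonneg (Finset.Icc_subset_Icc le_rfl hDQ)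
        fun _ _ _ => by positivity).trans hh
    calc _ ≤ h ^ 2 * h := by gcongr
      _ = _ := by ring
  have h0 : 0 ∈ Finset.range (Q + 1) := by simp
  simp only [freqMajorant, Finset.sum_add_distrib, ← Finset.mul_sum]
  have e1 : ∀ f : ℕ → ℕ → ℝ, (∑ i ∈ Finset.range (Q + 1), ∑ j ∈ Finset.range (Q + 1),
      ∑ l ∈ Finset.range (Q + 1), if l = 0 then f i j else 0) =
      ∑ i ∈ Finset.range (Q + 1), ∑ j ∈ Finset.range (Q + 1), f i j := fun f => by simp
  have e2 : ∀ f : ℕ → ℕ → ℝ, (∑ i ∈ Finset.range (Q + 1), ∑ j ∈ Finset.range (Q + 1),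
      ∑ l ∈ Finset.range (Q + 1), if j = 0 then f i l else 0) =
      ∑ i ∈ Finset.range (Q + 1), ∑ j ∈ Finset.range (Q + 1), f i j := fun f => by
    refine Finset.sum_congr rfl fun i _ => ?_
    rw [Finset.sum_comm]; simp
  have e3 : ∀ f : ℕ → ℕ → ℝ, (∑ i ∈ Finset.range (Q + 1), ∑ j ∈ Finset.range (Q + 1),
      ∑ l ∈ Finset.range (Q + 1), if i = 0 then f j l else 0) =
      ∑ i ∈ Finset.range (Q + 1), ∑ j ∈ Finset.range (Q + 1), f i j := fun f => by
    rw [Finset.sum_eq_single 0 (by simp +contextual) (by simp)]; simp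
  rw [e1 fun i j => (Nat.gcd i j : ℝ) / (i * j), e2 fun i j => (Nat.gcd i j : ℝ) / (i * j),
    e3 fun i j => (Nat.gcd i j : ℝ) / (i * j),
    e2 fun i l => if l = 0 then ∑ d ∈ Finset.Icc 1 D, (Nat.gcd d i : ℝ) / (d * i) else 0,
    e3 fun j l => if l = 0 then ∑ d ∈ Finset.Icc 1 D, (Nat.gcd d j : ℝ) / (d * j) else 0,
    e3 fun j l => if j = 0 then ∑ d ∈ Finset.Icc 1 D, (Nat.gcd d l : ℝ) / (d * l) else 0]
  have e4 : ∀ f : ℕ → ℝ, (∑ i ∈ Finset.range (Q + 1), ∑ l ∈ Finset.range (Q + 1),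
      if l = 0 then f i else 0) = ∑ i ∈ Finset.range (Q + 1), f i := fun f => by simp
  have e5 : ∀ f : ℕ → ℝ, (∑ i ∈ Finset.range (Q + 1), ∑ l ∈ Finset.range (Q + 1),
      if i = 0 then f l else 0) = ∑ i ∈ Finset.range (Q + 1), f i := fun f => by
    rw [Finset.sum_comm]; simp
  rw [e4 fun i => ∑ d ∈ Finset.Icc 1 D, (Nat.gcd d i : ℝ) / (d * i),
    e5 fun i => ∑ d ∈ Finset.Icc 1 D, (Nat.gcd d i : ℝ) / (d * i)]
  simp only [← Finset.sum_mul]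
  have hh' : 0 ≤ h := hh0.trans hh
  have t1 : (∑ i ∈ Finset.range (Q + 1), ∑ j ∈ Finset.range (Q + 1), (Nat.gcd i j : ℝ) / (i * j)) *
      ∑ l ∈ Finset.range (Q + 1), (1 : ℝ) / l ≤ h ^ 4 := by
    calc _ ≤ h ^ 3 * h := by
          gcongr
      _ = _ := by ring
  have u1 := mul_le_mul_of_nonneg_left t1 (by positivity : 0 ≤ K * (D : ℝ) ^ 3)
  have u2 := mul_le_mul_of_nonneg_left hGle (by positivity : 0 ≤ K * ((N : ℝ) * D))
  have u3 := mul_le_mul_of_nonneg_left hPle (by positivity : 0 ≤ (N : ℝ) ^ 2)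
  linarith

lemma norm_linearSum_neg_le (d : ℕ) [NeZero d] (N : ℕ) (a : ZMod (d ^ 2)) :
    ‖linearSum (d ^ 2) N (-a)‖ ≤ freqWeight d N a.valMinAbs.natAbs := by
  unfold freqWeight
  split_ifs with h
  · exact norm_linearSum_le _ _ _
  · have ha : -a ≠ 0 := by
      intro h0
      apply h
      rw [neg_eq_zero.1 h0]
      simp
    have := norm_linearSum_le_div (d ^ 2) N (-a) ha
    rw [ZMod.natAbs_valMinAbs_neg] at this
    exact_mod_cast this

/-- In the completed sum divided by `d⁶`, the zero frequency is the main term. The other frequencies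
are bounded by `norm_quadricSum_le`, whose factor `d²` leaves `d⁻⁴`. -/
theorem abs_boxCount_sub_le {d : ℕ} [NeZero d] (hd : Squarefree d) (N : ℕ) (k : ℤ) :
    |(boxCount (d ^ 2) N k : ℝ) - (quadric (d ^ 2) k).card * (N : ℝ) ^ 3 / (d : ℝ) ^ 6| ≤
      (d.divisors.card : ℝ) ^ 4 / (d : ℝ) ^ 4 *
        ∑ u ∈ (Finset.univ : Finset (ZMod (d ^ 2) × ZMod (d ^ 2) × ZMod (d ^ 2))).erase 0,
          tripleWeight d N u.1.valMinAbs.natAbs u.2.1.valMinAbs.natAbs u.2.2.valMinAbs.natAbs := by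
  have hd0 : (0 : ℝ) < d := by exact_mod_cast Nat.pos_of_ne_zero (NeZero.ne d)
  have hcomp := boxCount_completion (d ^ 2) N k
  rw [← Finset.add_sum_erase _ _ (Finset.mem_univ
    (0 : ZMod (d ^ 2) × ZMod (d ^ 2) × ZMod (d ^ 2)))] at hcomp
  have hzero : quadricSum (d ^ 2) k (0 : ZMod (d ^ 2) × ZMod (d ^ 2) × ZMod (d ^ 2)).1
      (0 : ZMod (d ^ 2) × ZMod (d ^ 2) × ZMod (d ^ 2)).2.1
      (0 : ZMod (d ^ 2) × ZMod (d ^ 2) × ZMod (d ^ 2)).2.2 *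
      (linearSum (d ^ 2) N (-(0 : ZMod (d ^ 2) × ZMod (d ^ 2) × ZMod (d ^ 2)).1) *
      (linearSum (d ^ 2) N (-(0 : ZMod (d ^ 2) × ZMod (d ^ 2) × ZMod (d ^ 2)).2.1) *
      linearSum (d ^ 2) N (-(0 : ZMod (d ^ 2) × ZMod (d ^ 2) × ZMod (d ^ 2)).2.2))) =
      (quadric (d ^ 2) k).card * (N : ℂ) ^ 3 := by
    have h1 : quadricSum (d ^ 2) k 0 0 0 = (quadric (d ^ 2) k).card := by simp [quadricSum]
    have h2 : linearSum (d ^ 2) N (-0) = N := by simp [linearSum]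
    simp only [Prod.fst_zero, Prod.snd_zero]
    rw [h1, h2]
    ring
  rw [hzero] at hcomp
  set E := ∑ u ∈ (Finset.univ : Finset (ZMod (d ^ 2) × ZMod (d ^ 2) × ZMod (d ^ 2))).erase 0,
    quadricSum (d ^ 2) k u.1 u.2.1 u.2.2 * (linearSum (d ^ 2) N (-u.1) *
      (linearSum (d ^ 2) N (-u.2.1) * linearSum (d ^ 2) N (-u.2.2))) with hE
  have hEn : ‖E‖ ≤ ∑ u ∈ (Finset.univ : Finset (ZMod (d ^ 2) × ZMod (d ^ 2) × ZMod (d ^ 2))).erase 0,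
      (d : ℝ) ^ 2 * (d.divisors.card : ℝ) ^ 4 * tripleWeight d N u.1.valMinAbs.natAbs
        u.2.1.valMinAbs.natAbs u.2.2.valMinAbs.natAbs := by
    refine (norm_sum_le _ _).trans (Finset.sum_le_sum fun u _ => ?_)
    rw [norm_mul, norm_mul, norm_mul]
    have h1 := norm_quadricSum_le (d := d) k u.1.valMinAbs u.2.1.valMinAbs u.2.2.valMinAbs
    rw [ZMod.coe_valMinAbs, ZMod.coe_valMinAbs, ZMod.coe_valMinAbs] at h1
    have h2 := Nat.cast_le (α := ℝ).2
      (card_critSystem_le hd k u.1.valMinAbs u.2.1.valMinAbs u.2.2.valMinAbs)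
    have h3 := h1.trans (mul_le_mul_of_nonneg_left h2 (by positivity))
    have w := freqWeight_nonneg d N
    have h4 : ‖linearSum (d ^ 2) N (-u.1)‖ *
        (‖linearSum (d ^ 2) N (-u.2.1)‖ * ‖linearSum (d ^ 2) N (-u.2.2)‖) ≤
        freqWeight d N u.1.valMinAbs.natAbs * (freqWeight d N u.2.1.valMinAbs.natAbs *
          freqWeight d N u.2.2.valMinAbs.natAbs) := by
      have := norm_linearSum_neg_le d N
      gcongr
      · exact w _
      · exact this _
      · exact w _
      · exact this _
      · exact this _
    refine (mul_le_mul h3 h4 (by positivity) (by positivity)).trans (le_of_eq ?_)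
    unfold tripleWeight
    push_cast
    ring
  rw [← Finset.mul_sum] at hEn
  have hreal : (d : ℝ) ^ 6 * |(boxCount (d ^ 2) N k : ℝ) -
      (quadric (d ^ 2) k).card * (N : ℝ) ^ 3 / (d : ℝ) ^ 6| = ‖E‖ := by
    have : E = (((d : ℝ) ^ 6 * ((boxCount (d ^ 2) N k : ℝ) -
      (quadric (d ^ 2) k).card * (N : ℝ) ^ 3 / (d : ℝ) ^ 6) : ℝ) : ℂ) := by
      have h1 : (d : ℝ) ^ 6 * ((boxCount (d ^ 2) N k : ℝ) -
        (quadric (d ^ 2) k).card * (N : ℝ) ^ 3 / (d : ℝ) ^ 6) =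
        (d : ℝ) ^ 6 * (boxCount (d ^ 2) N k : ℝ) - (quadric (d ^ 2) k).card * (N : ℝ) ^ 3 := by
        field_simp
      rw [h1]
      push_cast at hcomp ⊢
      linear_combination -hcomp
    rw [this, Complex.norm_real, Real.norm_eq_abs, abs_mul, abs_of_pos (pow_pos hd0 6)]
  rw [← hreal] at hEn
  refine le_of_mul_le_mul_left (hEn.trans (le_of_eq ?_)) (pow_pos hd0 6)
  field_simp

lemma card_natAbs_valMinAbs_fiber_le (q : ℕ) [NeZero q] (i : ℕ) :
    (Finset.univ.filter fun a : ZMod q => a.valMinAbs.natAbs = i).card ≤ 2 := by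
  rcases (Finset.univ.filter fun a : ZMod q => a.valMinAbs.natAbs = i).eq_empty_or_nonempty
    with h | ⟨r, hr⟩
  · simp [h]
  · refine (Finset.card_le_card (t := {r, -r}) ?_).trans Finset.card_le_two
    intro t ht
    simp only [Finset.mem_filter, Finset.mem_univ, true_and, Finset.mem_insert,
      Finset.mem_singleton] at *
    exact ZMod.natAbs_valMinAbs_eq_natAbs_valMinAbs.1 (ht.trans hr.symm)

/-- Passes from residues to absolute values of representatives: each absolute value has at most two
preimages `± a`, whence `8 = 2³`. The enlarged range `Q` is independent of `q`, so that the sum over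
moduli can later be moved inside. -/
lemma sum_valMinAbs_le (q : ℕ) [NeZero q] (Q : ℕ) (hQ : q ≤ Q) (f : ℕ → ℕ → ℕ → ℝ)
    (hf : ∀ i j l, 0 ≤ f i j l) :
    ∑ u ∈ (Finset.univ : Finset (ZMod q × ZMod q × ZMod q)).erase 0,
      f u.1.valMinAbs.natAbs u.2.1.valMinAbs.natAbs u.2.2.valMinAbs.natAbs ≤
    8 * ∑ i ∈ Finset.range (Q + 1), ∑ j ∈ Finset.range (Q + 1), ∑ l ∈ Finset.range (Q + 1),
      if i = 0 ∧ j = 0 ∧ l = 0 then 0 else f i j l := by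
  classical
  let g : ℕ × ℕ × ℕ → ℝ := fun t => if t.1 = 0 ∧ t.2.1 = 0 ∧ t.2.2 = 0 then 0 else f t.1 t.2.1 t.2.2
  let π : ZMod q × ZMod q × ZMod q → ℕ × ℕ × ℕ := fun u =>
    (u.1.valMinAbs.natAbs, u.2.1.valMinAbs.natAbs, u.2.2.valMinAbs.natAbs)
  have hg0 : ∀ t, 0 ≤ g t := fun t => by
    simp only [g]; split_ifs
    · exact le_rfl
    · exact hf _ _ _
  have hrange : ∀ a : ZMod q, a.valMinAbs.natAbs ∈ Finset.range (Q + 1) := fun a => by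
    have := ZMod.natAbs_valMinAbs_le a
    rw [Finset.mem_range]; omega
  have h1 : ∑ u ∈ (Finset.univ : Finset (ZMod q × ZMod q × ZMod q)).erase 0,
      f u.1.valMinAbs.natAbs u.2.1.valMinAbs.natAbs u.2.2.valMinAbs.natAbs =
      ∑ u ∈ (Finset.univ : Finset (ZMod q × ZMod q × ZMod q)).erase 0, g (π u) := by
    refine Finset.sum_congr rfl fun u hu => ?_
    have hu0 := (Finset.mem_erase.1 hu).1
    simp only [g, π]
    rw [if_neg]
    simp only [Int.natAbs_eq_zero, ZMod.valMinAbs_eq_zero]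
    rintro ⟨h1, h2, h3⟩
    exact hu0 (Prod.ext h1 (Prod.ext h2 h3))
  have h2 : ∑ i ∈ Finset.range (Q + 1), ∑ j ∈ Finset.range (Q + 1), ∑ l ∈ Finset.range (Q + 1),
      (if i = 0 ∧ j = 0 ∧ l = 0 then 0 else f i j l) =
      ∑ t ∈ Finset.range (Q + 1) ×ˢ Finset.range (Q + 1) ×ˢ Finset.range (Q + 1), g t := by
    rw [Finset.sum_product]
    refine Finset.sum_congr rfl fun i _ => ?_
    rw [Finset.sum_product]
  have hmaps : ∀ u ∈ (Finset.univ : Finset (ZMod q × ZMod q × ZMod q)).erase 0, π u ∈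
      Finset.range (Q + 1) ×ˢ Finset.range (Q + 1) ×ˢ Finset.range (Q + 1) := fun u _ => by
    simp only [π, Finset.mem_product]
    exact ⟨hrange _, hrange _, hrange _⟩
  rw [h1, h2, ← Finset.sum_fiberwise_of_maps_to hmaps, Finset.mul_sum]
  refine Finset.sum_le_sum fun t _ => ?_
  calc ∑ u ∈ ((Finset.univ : Finset (ZMod q × ZMod q × ZMod q)).erase 0).filter (fun u => π u = t),
        g (π u) = ∑ u ∈ ((Finset.univ : Finset (ZMod q × ZMod q × ZMod q)).erase 0).filter
          (fun u => π u = t), g t :=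
        Finset.sum_congr rfl fun u hu => by rw [(Finset.mem_filter.1 hu).2]
    _ = (((Finset.univ : Finset (ZMod q × ZMod q × ZMod q)).erase 0).filter
          (fun u => π u = t)).card * g t := by rw [Finset.sum_const, nsmul_eq_mul]
    _ ≤ 8 * g t := by
        refine mul_le_mul_of_nonneg_right ?_ (hg0 t)
        let T := fun i : ℕ => Finset.univ.filter fun a : ZMod q => a.valMinAbs.natAbs = i
        have hT : ∀ r, (T r).card ≤ 2 := card_natAbs_valMinAbs_fiber_le q
        have : (((Finset.univ : Finset (ZMod q × ZMod q × ZMod q)).erase 0).filter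
          (fun u => π u = t)).card ≤ (T t.1 ×ˢ T t.2.1 ×ˢ T t.2.2).card := by
          refine Finset.card_le_card fun u hu => ?_
          have := (Finset.mem_filter.1 hu).2
          simp [T, ← this, π]
        have h8 : (T t.1 ×ˢ T t.2.1 ×ˢ T t.2.2).card ≤ 2 * (2 * 2) := by
          simp only [Finset.card_product]
          gcongr <;> exact hT _
        exact_mod_cast this.trans h8

/-- The error of `boxCount` for the modulus `d ^ 2`. -/
noncomputable def boxError (d N : ℕ) (k : ℤ) : ℝ :=
  if h : d = 0 then 0 else
    haveI : NeZero d := ⟨h⟩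
    (boxCount (d ^ 2) N k : ℝ) - (quadric (d ^ 2) k).card * (N : ℝ) ^ 3 / (d : ℝ) ^ 6

/-- All frequencies are put in the common range `[0, D²]`, so the order of summation can be
exchanged and each nonzero frequency averaged over `d`. Then `i² + j² + l² ≤ 3 D⁴`, the range in
which `K` must bound the divisor function. -/
theorem sum_abs_boxError_le (D N : ℕ) (k : ℤ) {K h B : ℝ}
    (hB : ∀ d ∈ Finset.Icc 1 D, (d.divisors.card : ℝ) ≤ B)
    (hK0 : 0 ≤ K) (hK : ∀ n : ℕ, n ≠ 0 → n ≤ 3 * D ^ 4 → (n.divisors.card : ℝ) ≤ K)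
    (hh : ∑ i ∈ Finset.Icc 1 (D ^ 2), (1 : ℝ) / i ≤ h) :
    ∑ d ∈ (Finset.Icc 1 D).filter Squarefree, |boxError d N k| ≤
      8 * B ^ 4 * (K * D ^ 3 * h ^ 4 + 3 * (K * (N * D) * h ^ 3) + 3 * (N ^ 2 * h ^ 3)) := by
  have hDQ : D ≤ D ^ 2 := Nat.le_self_pow two_ne_zero D
  have hper : ∀ d ∈ (Finset.Icc 1 D).filter Squarefree, |boxError d N k| ≤
      8 * B ^ 4 * ∑ i ∈ Finset.range (D ^ 2 + 1), ∑ j ∈ Finset.range (D ^ 2 + 1),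
        ∑ l ∈ Finset.range (D ^ 2 + 1),
          (if i = 0 ∧ j = 0 ∧ l = 0 then 0 else tripleWeight d N i j l) / (d : ℝ) ^ 4 := by
    intro d hd
    obtain ⟨hd1, hsf⟩ := Finset.mem_filter.1 hd
    obtain ⟨hd2, hd3⟩ := Finset.mem_Icc.1 hd1
    have hdne : d ≠ 0 := by omega
    have : NeZero d := ⟨hdne⟩
    simp only [boxError, hdne, dif_neg, not_false_eq_true]
    refine (abs_boxCount_sub_le hsf N k).trans ?_
    have h1 := sum_valMinAbs_le (d ^ 2) (D ^ 2) (Nat.pow_le_pow_left hd3 2) (tripleWeight d N)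
      (tripleWeight_nonneg d N)
    have h2 := hB d hd1
    simp only [← Finset.sum_div]
    have h0 : 0 ≤ ∑ i ∈ Finset.range (D ^ 2 + 1), ∑ j ∈ Finset.range (D ^ 2 + 1),
        ∑ l ∈ Finset.range (D ^ 2 + 1),
          if i = 0 ∧ j = 0 ∧ l = 0 then 0 else tripleWeight d N i j l :=
      Finset.sum_nonneg fun i _ => Finset.sum_nonneg fun j _ => Finset.sum_nonneg fun l _ => by
        split_ifs
        · exact le_rfl
        · exact tripleWeight_nonneg ..
    calc _ ≤ B ^ 4 / (d : ℝ) ^ 4 * (8 * ∑ i ∈ Finset.range (D ^ 2 + 1),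
          ∑ j ∈ Finset.range (D ^ 2 + 1), ∑ l ∈ Finset.range (D ^ 2 + 1),
          if i = 0 ∧ j = 0 ∧ l = 0 then 0 else tripleWeight d N i j l) := by
          gcongr
          exact Finset.sum_nonneg fun u _ => tripleWeight_nonneg ..
      _ = _ := by ring
  refine (Finset.sum_le_sum hper).trans ?_
  rw [← Finset.mul_sum]
  refine mul_le_mul_of_nonneg_left ?_ (by positivity)
  refine le_trans ?_ (sum_freqMajorant_le D N (D ^ 2) hDQ hK0 hh)
  rw [Finset.sum_comm]
  refine Finset.sum_le_sum fun i hi => ?_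
  rw [Finset.sum_comm]
  refine Finset.sum_le_sum fun j hj => ?_
  rw [Finset.sum_comm]
  refine Finset.sum_le_sum fun l hl => ?_
  have hnonneg : ∀ d : ℕ, 0 ≤ tripleWeight d N i j l / (d : ℝ) ^ 4 := fun d =>
    div_nonneg (tripleWeight_nonneg ..) (by positivity)
  by_cases h0 : i = 0 ∧ j = 0 ∧ l = 0
  · simp only [h0, and_self, if_true, zero_div, Finset.sum_const_zero]
    simp [freqMajorant]
  · simp only [h0, if_false]
    refine (Finset.sum_le_sum_of_subset_of_nonneg (Finset.filter_subset _ _)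
      fun d _ _ => hnonneg d).trans (sum_tripleWeight_le_freqMajorant D N h0 (hK _ ?_ ?_))
    · intro h
      simp only [Nat.add_eq_zero_iff, pow_eq_zero_iff, ne_eq, OfNat.ofNat_ne_zero,
        not_false_eq_true] at h
      exact h0 ⟨h.1.1, h.1.2, h.2⟩
    · rw [Finset.mem_range] at hi hj hl
      have e : D ^ 4 = (D ^ 2) ^ 2 := by ring
      rw [e]
      have := Nat.pow_le_pow_left (Nat.lt_succ_iff.1 hi) 2
      have := Nat.pow_le_pow_left (Nat.lt_succ_iff.1 hj) 2
      have := Nat.pow_le_pow_left (Nat.lt_succ_iff.1 hl) 2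
      omega

theorem exists_sum_abs_boxError_le {ε : ℝ} (hε : 0 < ε) :
    ∃ C : ℝ, 0 ≤ C ∧ ∀ (k : ℤ) (D N : ℕ), 1 ≤ D → D ≤ N →
      ∑ d ∈ (Finset.Icc 1 D).filter Squarefree, |boxError d N k| ≤
        C * (N : ℝ) ^ ε * (D ^ 3 + N * D + N ^ 2) := by
  -- With `M = N ^ δ`, the factors `B ^ 4`, `K` and `h ^ 4` cost `M ^ 4`, `M ^ 4` and `M ^ 8`.
  set δ := ε / 16 with hδ
  have hδ0 : 0 < δ := by positivity
  obtain ⟨C₁, hC₁, hτ⟩ := exists_card_divisors_le hδ0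
  obtain ⟨C₂, hC₂, hH⟩ := exists_harmonic_le hδ0
  refine ⟨8 * C₁ ^ 4 * (3 * (C₁ * 3 ^ δ) * C₂ ^ 4), by positivity, fun k D N hD hDN => ?_⟩
  set M : ℝ := (N : ℝ) ^ δ with hM
  have hN1 : (1 : ℝ) ≤ N := by exact_mod_cast hD.trans hDN
  have hDN' : (D : ℝ) ≤ N := by exact_mod_cast hDN
  have hM1 : 1 ≤ M := Real.one_le_rpow hN1 hδ0.le
  have hMpow : ∀ m : ℕ, ((N : ℝ) ^ m) ^ δ = M ^ m := fun m => by
    rw [hM, ← Real.rpow_natCast, ← Real.rpow_natCast, ← Real.rpow_mul (by positivity),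
      ← Real.rpow_mul (by positivity), mul_comm]
  have h3 : (1 : ℝ) ≤ 3 ^ δ := Real.one_le_rpow (by norm_num) hδ0.le
  have hMε : M ^ 16 = (N : ℝ) ^ ε := by
    rw [hM, ← Real.rpow_natCast, ← Real.rpow_mul (by positivity), hδ]
    congr 1; push_cast; ring
  have key := sum_abs_boxError_le D N k (K := C₁ * 3 ^ δ * M ^ 4) (h := C₂ * M ^ 2) (B := C₁ * M)
    ?_ (by positivity) ?_ ?_
  · refine key.trans ?_
    rw [← hMε]
    have hh1 : (1 : ℝ) ≤ C₂ * M ^ 2 := one_le_mul_of_one_le_of_one_le hC₂ (one_le_pow₀ hM1)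
    have hK1 : (1 : ℝ) ≤ C₁ * 3 ^ δ * M ^ 4 :=
      one_le_mul_of_one_le_of_one_le (one_le_mul_of_one_le_of_one_le hC₁ h3) (one_le_pow₀ hM1)
    have hh34 : (C₂ * M ^ 2) ^ 3 ≤ (C₂ * M ^ 2) ^ 4 := pow_le_pow_right₀ hh1 (by norm_num)
    calc _ ≤ 8 * (C₁ * M) ^ 4 * (C₁ * 3 ^ δ * M ^ 4 * D ^ 3 * (C₂ * M ^ 2) ^ 4 +
          3 * (C₁ * 3 ^ δ * M ^ 4 * (N * D) * (C₂ * M ^ 2) ^ 4) +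
          3 * ((C₁ * 3 ^ δ * M ^ 4) * N ^ 2 * (C₂ * M ^ 2) ^ 4)) := by
          have : (N : ℝ) ^ 2 * (C₂ * M ^ 2) ^ 3 ≤
              (C₁ * 3 ^ δ * M ^ 4) * N ^ 2 * (C₂ * M ^ 2) ^ 4 := by
            have h := mul_le_mul hK1 (mul_le_mul_of_nonneg_left hh34
              (by positivity : (0 : ℝ) ≤ (N : ℝ) ^ 2)) (by positivity) (by positivity)
            linarith
          gcongr
      _ ≤ 8 * (C₁ * M) ^ 4 * (3 * (C₁ * 3 ^ δ * M ^ 4 * D ^ 3 * (C₂ * M ^ 2) ^ 4) +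
          3 * (C₁ * 3 ^ δ * M ^ 4 * (N * D) * (C₂ * M ^ 2) ^ 4) +
          3 * ((C₁ * 3 ^ δ * M ^ 4) * N ^ 2 * (C₂ * M ^ 2) ^ 4)) := by
          have : (0 : ℝ) ≤ C₁ * 3 ^ δ * M ^ 4 * D ^ 3 * (C₂ * M ^ 2) ^ 4 := by positivity
          refine mul_le_mul_of_nonneg_left ?_ (by positivity)
          linarith
      _ = _ := by ring
  · intro d hd
    obtain ⟨hd1, hd2⟩ := Finset.mem_Icc.1 hd
    refine (hτ d (by omega)).trans ?_
    have : (d : ℝ) ≤ N := by exact_mod_cast hd2.trans hDN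
    rw [hM]
    gcongr
  · intro n hn hn'
    refine (hτ n hn).trans ?_
    have : (n : ℝ) ≤ 3 * (N : ℝ) ^ 4 := by
      calc (n : ℝ) ≤ 3 * (D : ℝ) ^ 4 := by exact_mod_cast hn'
        _ ≤ _ := by gcongr
    calc C₁ * (n : ℝ) ^ δ ≤ C₁ * (3 * (N : ℝ) ^ 4) ^ δ := by gcongr
      _ = _ := by
        rw [Real.mul_rpow (by norm_num) (by positivity), hMpow]; ring
  · refine (hH (D ^ 2) (Nat.one_le_pow _ _ hD)).trans ?_
    have : ((D ^ 2 : ℕ) : ℝ) ≤ (N : ℝ) ^ 2 := by push_cast; gcongr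
    calc C₂ * ((D ^ 2 : ℕ) : ℝ) ^ δ ≤ C₂ * ((N : ℝ) ^ 2) ^ δ := by gcongr
      _ = _ := by rw [hMpow]

/-! ### The singular series and its Euler product -/

lemma sum_Icc_natCast_eq (q : ℕ) [NeZero q] (v : ZMod q) :
    ∑ x ∈ Finset.Icc 1 q, (if (x : ZMod q) = v then (1 : ℂ) else 0) = 1 := by
  have hq : 0 < q := Nat.pos_of_ne_zero (NeZero.ne q)
  obtain ⟨x₀, hx₀, hv⟩ : ∃ x₀ ∈ Finset.Icc 1 q, (x₀ : ZMod q) = v := by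
    by_cases h : v = 0
    · exact ⟨q, by simp; omega, by simp [h]⟩
    · refine ⟨v.val, ?_, ZMod.natCast_zmod_val v⟩
      have := ZMod.val_lt v
      have : v.val ≠ 0 := by rwa [Ne, ZMod.val_eq_zero]
      rw [Finset.mem_Icc]; omega
  rw [Finset.sum_eq_single x₀, if_pos hv]
  · intro x hx hne
    rw [if_neg]
    intro h
    apply hne
    rw [← hv, ZMod.natCast_eq_natCast_iff] at h
    rw [Finset.mem_Icc] at hx hx₀
    have h1 : x - 1 ≡ x₀ - 1 [MOD q] := by
      have e1 : x = x - 1 + 1 := by omega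
      have e2 : x₀ = x₀ - 1 + 1 := by omega
      rw [e1, e2] at h
      exact Nat.ModEq.add_right_cancel' 1 h
    have := Nat.ModEq.eq_of_lt_of_lt h1 (by omega) (by omega)
    omega
  · exact fun h => absurd hx₀ h

theorem lambda_eq_card_quadric (q : ℕ) [NeZero q] (k : ℤ) : lambda q k = (quadric q k).card := by
  have h1 : lambda q k = boxCount q q k := by
    unfold lambda boxCount
    congr 1
    refine Finset.filter_congr fun t _ => ?_
    rw [Int.modEq_zero_iff_dvd]
  have h2 := boxCount_eq_sum_quadric q q k
  simp only [sum_Icc_natCast_eq, mul_one, Finset.sum_const, nsmul_eq_mul] at h2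
  rw [h1]
  exact_mod_cast h2

lemma map_mem_quadric {d e : ℕ} [NeZero d] [NeZero e] {k : ℤ} (φ : ZMod d →+* ZMod e)
    {v : ZMod d × ZMod d × ZMod d} (hv : v ∈ quadric d k) :
    (φ v.1, φ v.2.1, φ v.2.2) ∈ quadric e k := by
  simp only [quadric, Finset.mem_filter, Finset.mem_univ, true_and] at hv ⊢
  simpa only [map_add, map_pow, map_intCast, map_zero] using congrArg φ hv

theorem card_quadric_mul {m n : ℕ} [NeZero m] [NeZero n] (h : Nat.Coprime m n) (k : ℤ) :
    (quadric (m * n) k).card = (quadric m k).card * (quadric n k).card := by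
  let e := ZMod.chineseRemainder h
  let φ : ZMod (m * n) →+* ZMod m := (RingHom.fst _ _).comp e.toRingHom
  let ψ : ZMod (m * n) →+* ZMod n := (RingHom.snd _ _).comp e.toRingHom
  have hinj : ∀ x y, φ x = φ y → ψ x = ψ y → x = y := fun x y h1 h2 =>
    e.injective (Prod.ext h1 h2)
  have hsurj : ∀ a b, ∃ x, φ x = a ∧ ψ x = b := fun a b => ⟨e.symm (a, b), by simp [φ], by simp [ψ]⟩
  rw [← Finset.card_product]
  refine Finset.card_bij (fun v _ => ((φ v.1, φ v.2.1, φ v.2.2), (ψ v.1, ψ v.2.1, ψ v.2.2)))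
    ?_ ?_ ?_
  · intro v hv
    exact Finset.mem_product.2 ⟨map_mem_quadric φ hv, map_mem_quadric ψ hv⟩
  · rintro ⟨x, y, z⟩ - ⟨x', y', z'⟩ - hv
    simp only [Prod.mk.injEq] at hv ⊢
    obtain ⟨⟨h1, h2, h3⟩, g1, g2, g3⟩ := hv
    exact ⟨hinj _ _ h1 g1, hinj _ _ h2 g2, hinj _ _ h3 g3⟩
  · rintro ⟨⟨a, b, c⟩, a', b', c'⟩ hw
    obtain ⟨h1, h2⟩ := Finset.mem_product.1 hw
    obtain ⟨x, rfl, rfl⟩ := hsurj a a'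
    obtain ⟨y, rfl, rfl⟩ := hsurj b b'
    obtain ⟨z, rfl, rfl⟩ := hsurj c c'
    refine ⟨(x, y, z), ?_, rfl⟩
    simp only [quadric, Finset.mem_filter, Finset.mem_univ, true_and] at h1 h2 ⊢
    apply hinj
    · simpa only [map_add, map_pow, map_intCast, map_zero] using h1
    · simpa only [map_add, map_pow, map_intCast, map_zero] using h2

/-- The exponential sum bound at frequency zero, where both gcds equal `d`. -/
lemma lambda_sq_le {d : ℕ} (hd : Squarefree d) (k : ℤ) :
    (lambda (d ^ 2) k : ℝ) ≤ (d.divisors.card : ℝ) ^ 4 * (d : ℝ) ^ 4 := by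
  have : NeZero d := ⟨hd.ne_zero⟩
  have h1 := norm_quadricSum_le (d := d) k 0 0 0
  have h2 : quadricSum (d ^ 2) k ((0 : ℤ) : ZMod (d ^ 2)) ((0 : ℤ) : ZMod (d ^ 2))
      ((0 : ℤ) : ZMod (d ^ 2)) = (quadric (d ^ 2) k).card := by simp [quadricSum]
  rw [h2, Complex.norm_natCast] at h1
  have h3 := card_critSystem_le hd k 0 0 0
  simp only [Int.natAbs_zero, ne_eq, OfNat.ofNat_ne_zero, not_false_eq_true, zero_pow, add_zero,
    Nat.gcd_zero_right] at h3
  have h4 : ((critSystem d k 0 0 0).card : ℝ) ≤ (d.divisors.card : ℝ) ^ 4 * d * d := by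
    exact_mod_cast h3
  rw [lambda_eq_card_quadric]
  calc _ ≤ _ := h1
    _ ≤ (d : ℝ) ^ 2 * ((d.divisors.card : ℝ) ^ 4 * d * d) := by gcongr
    _ = _ := by ring

/-- The general term of the singular series. -/
noncomputable def singularTerm (k : ℤ) (d : ℕ) : ℝ :=
  ArithmeticFunction.moebius d * (lambda (d ^ 2) k : ℝ) / (d : ℝ) ^ 6

lemma singularTerm_zero (k : ℤ) : singularTerm k 0 = 0 := by simp [singularTerm]

lemma singularTerm_one (k : ℤ) : singularTerm k 1 = 1 := by
  have : lambda 1 k = 1 := by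
    rw [lambda_eq_card_quadric, Finset.card_eq_one]
    refine ⟨0, Finset.eq_singleton_iff_unique_mem.2 ⟨?_, fun x _ => Subsingleton.elim _ _⟩⟩
    simp only [quadric, Finset.mem_filter, Finset.mem_univ, true_and]
    exact Subsingleton.elim _ _
  simp [singularTerm, this]

lemma singularTerm_mul (k : ℤ) {m n : ℕ} (h : Nat.Coprime m n) :
    singularTerm k (m * n) = singularTerm k m * singularTerm k n := by
  rcases Nat.eq_zero_or_pos m with rfl | hm
  · simp [singularTerm_zero]
  rcases Nat.eq_zero_or_pos n with rfl | hn
  · simp [singularTerm_zero]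
  have : NeZero m := ⟨hm.ne'⟩
  have : NeZero n := ⟨hn.ne'⟩
  have h2 : lambda ((m * n) ^ 2) k = lambda (m ^ 2) k * lambda (n ^ 2) k := by
    rw [mul_pow, lambda_eq_card_quadric, lambda_eq_card_quadric, lambda_eq_card_quadric,
      card_quadric_mul (h.pow 2 2)]
  unfold singularTerm
  rw [h2, ArithmeticFunction.isMultiplicative_moebius.map_mul_of_coprime h]
  push_cast
  field_simp

lemma abs_singularTerm_le (k : ℤ) (d : ℕ) :
    |singularTerm k d| ≤ (d.divisors.card : ℝ) ^ 4 / (d : ℝ) ^ 2 := by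
  by_cases hd : Squarefree d
  · have hd0 : (0 : ℝ) < d := by exact_mod_cast Nat.pos_of_ne_zero hd.ne_zero
    have hμ : |((ArithmeticFunction.moebius d : ℤ) : ℝ)| = 1 := by
      rw [← Int.cast_abs, ArithmeticFunction.abs_moebius_eq_one_of_squarefree hd, Int.cast_one]
    unfold singularTerm
    rw [abs_div, abs_mul, hμ, one_mul, abs_of_nonneg (Nat.cast_nonneg _),
      abs_of_nonneg (by positivity), div_le_div_iff₀ (by positivity) (by positivity)]
    calc (lambda (d ^ 2) k : ℝ) * d ^ 2 ≤ ((d.divisors.card : ℝ) ^ 4 * (d : ℝ) ^ 4) * d ^ 2 := by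
          gcongr; exact lambda_sq_le hd k
      _ = _ := by ring
  · simp only [singularTerm, ArithmeticFunction.moebius_eq_zero_of_not_squarefree hd]
    simp
    positivity

lemma exists_abs_singularTerm_le {δ : ℝ} (hδ : 0 < δ) :
    ∃ C : ℝ, 0 ≤ C ∧ ∀ (k : ℤ) (d : ℕ), 1 ≤ d → |singularTerm k d| ≤ C * (d : ℝ) ^ (-2 + δ) := by
  obtain ⟨C, hC, hτ⟩ := exists_card_divisors_le (ε := δ / 4) (by positivity)
  refine ⟨C ^ 4, by positivity, fun k d hd => (abs_singularTerm_le k d).trans ?_⟩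
  have hd0 : (0 : ℝ) < d := by exact_mod_cast hd
  have h1 := pow_le_pow_left₀ (by positivity) (hτ d (by omega)) 4
  rw [div_le_iff₀ (by positivity), mul_assoc, ← Real.rpow_natCast (d : ℝ) 2, ← Real.rpow_add hd0]
  refine h1.trans (le_of_eq ?_)
  rw [mul_pow, ← Real.rpow_natCast ((d : ℝ) ^ (δ / 4)) 4, ← Real.rpow_mul hd0.le]
  congr 2
  push_cast; ring

/-- Convergence of the singular series with a power saving for the tail. -/
theorem exists_singularTerm_tail_le {δ : ℝ} (hδ : 0 < δ) (hδ1 : δ ≤ 1 / 4) :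
    ∃ C : ℝ, 0 ≤ C ∧ ∀ k : ℤ, Summable (fun d => ‖singularTerm k d‖) ∧ ∀ D : ℕ, 1 ≤ D →
      |∑ d ∈ Finset.Icc 1 D, singularTerm k d - ∑' d, singularTerm k d| ≤
        C * (D : ℝ) ^ (-1 + 2 * δ) := by
  obtain ⟨C, hC, hb⟩ := exists_abs_singularTerm_le hδ
  have hsum : Summable fun n : ℕ => (n : ℝ) ^ (-1 - δ) := Real.summable_nat_rpow.2 (by linarith)
  set Z := ∑' n : ℕ, (n : ℝ) ^ (-1 - δ) with hZ
  have hZ0 : 0 ≤ Z := tsum_nonneg fun n => by positivity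
  refine ⟨C * Z, by positivity, fun k => ?_⟩
  -- Split `-2 + δ = (-1 + 2δ) + (-1 - δ)`: the first power is decreasing and is evaluated at `D`,
  -- the second is summable. The case `D = 1` gives absolute convergence.
  have hbd : ∀ D d : ℕ, 1 ≤ D → D ≤ d →
      |singularTerm k d| ≤ C * (D : ℝ) ^ (-1 + 2 * δ) * (d : ℝ) ^ (-1 - δ) := by
    intro D d hD hDd
    have hd0 : (0 : ℝ) < d := by exact_mod_cast hD.trans hDd
    have hD0 : (0 : ℝ) < D := by exact_mod_cast hD
    refine (hb k d (hD.trans hDd)).trans ?_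
    rw [mul_assoc]
    refine mul_le_mul_of_nonneg_left ?_ hC
    calc (d : ℝ) ^ (-2 + δ) = (d : ℝ) ^ (-1 + 2 * δ) * (d : ℝ) ^ (-1 - δ) := by
          rw [← Real.rpow_add hd0]; congr 1; ring
      _ ≤ _ := by
          refine mul_le_mul_of_nonneg_right ?_ (by positivity)
          exact Real.rpow_le_rpow_of_nonpos hD0 (by exact_mod_cast hDd) (by linarith)
  have hsumm : Summable (fun d => ‖singularTerm k d‖) := by
    refine Summable.of_nonneg_of_le (fun _ => norm_nonneg _) (fun d => ?_) (hsum.mul_left C)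
    rcases Nat.eq_zero_or_pos d with rfl | hd
    · rw [singularTerm_zero, norm_zero]; positivity
    · have := hbd 1 d le_rfl hd
      simpa using this
  refine ⟨hsumm, fun D hD => ?_⟩
  have hsplit := hsumm.of_norm.sum_add_tsum_nat_add (D + 1)
  rw [sum_range_eq_sum_Icc (singularTerm_zero k)] at hsplit
  rw [← hsplit, sub_add_cancel_left, abs_neg, ← Real.norm_eq_abs]
  have hs1 : Summable fun i => ‖singularTerm k (i + (D + 1))‖ :=
    (summable_nat_add_iff (f := fun d => ‖singularTerm k d‖) (D + 1)).2 hsumm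
  have hs2 : Summable fun i : ℕ => ((i + (D + 1) : ℕ) : ℝ) ^ (-1 - δ) :=
    (summable_nat_add_iff (f := fun d : ℕ => (d : ℝ) ^ (-1 - δ)) (D + 1)).2 hsum
  refine (norm_tsum_le_tsum_norm hs1).trans ?_
  calc ∑' i, ‖singularTerm k (i + (D + 1))‖
      ≤ ∑' i : ℕ, C * (D : ℝ) ^ (-1 + 2 * δ) * ((i + (D + 1) : ℕ) : ℝ) ^ (-1 - δ) :=
        hs1.tsum_le_tsum (fun i => hbd D _ hD (by omega)) (hs2.mul_left _)
    _ = C * (D : ℝ) ^ (-1 + 2 * δ) * ∑' i : ℕ, ((i + (D + 1) : ℕ) : ℝ) ^ (-1 - δ) := tsum_mul_left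
    _ ≤ C * (D : ℝ) ^ (-1 + 2 * δ) * Z := by
        refine mul_le_mul_of_nonneg_left ?_ (by positivity)
        have := hsum.sum_add_tsum_nat_add (D + 1)
        rw [hZ, ← this]
        exact le_add_of_nonneg_left (Finset.sum_nonneg fun _ _ => by positivity)
    _ = _ := by ring

/-- The Euler product of the singular series. -/
theorem hasProd_singular (k : ℤ) :
    HasProd (fun p : Nat.Primes => (1 : ℝ) - (lambda ((p : ℕ) ^ 2) k : ℝ) / ((p : ℕ) : ℝ) ^ 6)
      (∑' d, singularTerm k d) := by
  obtain ⟨_, _, hC⟩ := exists_singularTerm_tail_le (δ := 1 / 4) (by norm_num) le_rfl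
  have := EulerProduct.eulerProduct_hasProd (singularTerm_one k) (singularTerm_mul k) (hC k).1
    (singularTerm_zero k)
  have hterm : (fun p : Nat.Primes => (1 : ℝ) - (lambda ((p : ℕ) ^ 2) k : ℝ) / ((p : ℕ) : ℝ) ^ 6) =
      fun p : Nat.Primes => ∑' e : ℕ, singularTerm k ((p : ℕ) ^ e) := by
    funext p
    symm
    -- The Möbius factor kills every `p ^ e` with `e ≥ 2`.
    rw [tsum_eq_sum (s := Finset.range 2)]
    · rw [Finset.sum_range_succ, Finset.sum_range_one, pow_zero, pow_one, singularTerm_one]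
      simp only [singularTerm, ArithmeticFunction.moebius_apply_prime p.2]
      push_cast
      ring
    · intro e he
      have he2 : 1 < e := by simpa using he
      have : ¬Squarefree ((p : ℕ) ^ e) := fun h => by
        have h1 := (Nat.squarefree_pow_iff p.2.ne_one (by omega : e ≠ 0)).1 h
        omega
      simp [singularTerm, ArithmeticFunction.moebius_eq_zero_of_not_squarefree this]
  rw [hterm]
  exact this

/-! ### Möbius sieve and large square divisors -/

/-- After removing `gcd(d, b)`, the square of what is left of `d` is prime to what is left of `b`,
so it divides the square-free `a` and is 1. -/
lemma dvd_of_sq_dvd_sq_mul {a b d : ℕ} (ha : Squarefree a) (hb : b ≠ 0) (h : d ^ 2 ∣ b ^ 2 * a) :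
    d ∣ b := by
  obtain ⟨d', b', hc, hd', hb'⟩ := Nat.exists_coprime d b
  set g := Nat.gcd d b with hg
  have hg0 : 0 < g := Nat.gcd_pos_of_pos_right _ (Nat.pos_of_ne_zero hb)
  rw [hd', hb', mul_pow, mul_pow, mul_right_comm] at h
  have h1 := Nat.dvd_of_mul_dvd_mul_right (pow_pos hg0 2) h
  have h2 : d' ^ 2 ∣ a := (Nat.Coprime.pow 2 2 hc).dvd_of_dvd_mul_left h1
  rw [sq] at h2
  have h3 : d' = 1 := Nat.isUnit_iff.1 (ha d' h2)
  rw [hd', h3, one_mul]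
  exact Nat.gcd_dvd_right d b

lemma sum_moebius_divisors (b : ℕ) :
    ∑ d ∈ b.divisors, ArithmeticFunction.moebius d = if b = 1 then 1 else 0 := by
  rw [← ArithmeticFunction.coe_zeta_mul_apply, ArithmeticFunction.coe_zeta_mul_moebius,
    ArithmeticFunction.one_apply]

/-- The indicator of square-free integers as a Möbius sum over square divisors. -/
theorem sum_moebius_sq_dvd {n : ℤ} (hn : n ≠ 0) {Y : ℕ} (hY : n.natAbs ≤ Y)
    [Decidable (Squarefree n)] :
    ∑ d ∈ (Finset.Icc 1 Y).filter (fun d : ℕ => ((d ^ 2 : ℕ) : ℤ) ∣ n),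
      ArithmeticFunction.moebius d = if Squarefree n then 1 else 0 := by
  -- With `|n| = b² a` and `a` square-free, `d² ∣ n` means `d ∣ b`, so the sum is `∑ μ(d)` over `d ∣
  -- b`, which detects `b = 1`.
  obtain ⟨a, b, hab, ha⟩ := Nat.sq_mul_squarefree n.natAbs
  have hn' : n.natAbs ≠ 0 := Int.natAbs_ne_zero.2 hn
  have hb : b ≠ 0 := by rintro rfl; exact hn' (by simpa using hab.symm)
  have hset : (Finset.Icc 1 Y).filter (fun d : ℕ => ((d ^ 2 : ℕ) : ℤ) ∣ n) = b.divisors := by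
    ext d
    simp only [Finset.mem_filter, Finset.mem_Icc, Nat.mem_divisors]
    rw [Int.natCast_dvd, ← hab]
    constructor
    · rintro ⟨-, h⟩
      exact ⟨dvd_of_sq_dvd_sq_mul ha hb h, hb⟩
    · rintro ⟨h, -⟩
      have hd0 := Nat.pos_of_dvd_of_pos h (Nat.pos_of_ne_zero hb)
      refine ⟨⟨hd0, ?_⟩, (pow_dvd_pow_of_dvd h 2).mul_right a⟩
      have h1 : d ∣ n.natAbs := by
        rw [← hab, sq, mul_assoc]; exact h.mul_right _
      exact (Nat.le_of_dvd (Nat.pos_of_ne_zero hn') h1).trans hY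
  rw [hset, sum_moebius_divisors b]
  refine if_congr ?_ rfl rfl
  rw [← Int.squarefree_natAbs, ← hab]
  constructor
  · rintro rfl; simpa using ha
  · intro h
    exact Nat.isUnit_iff.1 (h b ⟨a, by ring⟩)

/-- The polynomial `x² + y² + z² + k` on triples of natural numbers. -/
def ternary (k : ℤ) (t : ℕ × ℕ × ℕ) : ℤ := (t.1 : ℤ) ^ 2 + (t.2.1 : ℤ) ^ 2 + (t.2.2 : ℤ) ^ 2 + k

/-- The box `[1, N]³`. -/
def box (N : ℕ) : Finset (ℕ × ℕ × ℕ) := Finset.Icc 1 N ×ˢ Finset.Icc 1 N ×ˢ Finset.Icc 1 N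

lemma mem_box {N : ℕ} {t : ℕ × ℕ × ℕ} :
    t ∈ box N ↔ (1 ≤ t.1 ∧ t.1 ≤ N) ∧ (1 ≤ t.2.1 ∧ t.2.1 ≤ N) ∧ (1 ≤ t.2.2 ∧ t.2.2 ≤ N) := by
  simp [box, Finset.mem_product, Finset.mem_Icc]

lemma natAbs_ternary_le {N : ℕ} {t : ℕ × ℕ × ℕ} (ht : t ∈ box N) (k : ℤ) :
    (ternary k t).natAbs ≤ 3 * N ^ 2 + k.natAbs := by
  rw [mem_box] at ht
  obtain ⟨⟨-, h1⟩, ⟨-, h2⟩, ⟨-, h3⟩⟩ := ht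
  have h1 := Nat.pow_le_pow_left h1 2
  have h2 := Nat.pow_le_pow_left h2 2
  have h3 := Nat.pow_le_pow_left h3 2
  have : ternary k t = ((t.1 ^ 2 + t.2.1 ^ 2 + t.2.2 ^ 2 : ℕ) : ℤ) + k := by
    unfold ternary; push_cast; ring
  rw [this]
  refine (Int.natAbs_add_le _ _).trans ?_
  rw [Int.natAbs_natCast]
  omega

/-- A zero has `x² + y² + z² = |k|`, so all coordinates are at most `|k|`, whatever `N` is. -/
lemma card_ternary_eq_zero_le (N : ℕ) (k : ℤ) :
    ((box N).filter fun t => ternary k t = 0).card ≤ k.natAbs ^ 3 := by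
  have hsub : (box N).filter (fun t => ternary k t = 0) ⊆ box k.natAbs := by
    intro t ht
    obtain ⟨h1, h2⟩ := Finset.mem_filter.1 ht
    rw [mem_box] at h1 ⊢
    obtain ⟨⟨a1, -⟩, ⟨a2, -⟩, ⟨a3, -⟩⟩ := h1
    have hk : t.1 ^ 2 + t.2.1 ^ 2 + t.2.2 ^ 2 = k.natAbs := by
      have h3 : ((t.1 ^ 2 + t.2.1 ^ 2 + t.2.2 ^ 2 : ℕ) : ℤ) = -k := by
        unfold ternary at h2; push_cast; linarith
      have := congrArg Int.natAbs h3
      rwa [Int.natAbs_natCast, Int.natAbs_neg] at this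
    have b1 := Nat.le_self_pow two_ne_zero t.1
    have b2 := Nat.le_self_pow two_ne_zero t.2.1
    have b3 := Nat.le_self_pow two_ne_zero t.2.2
    refine ⟨⟨a1, ?_⟩, ⟨a2, ?_⟩, ⟨a3, ?_⟩⟩ <;> omega
  refine (Finset.card_le_card hsub).trans (le_of_eq ?_)
  simp only [box, Finset.card_product, Nat.card_Icc, add_tsub_cancel_right]
  ring

/-- The pairs `(t, d)` with `t` in the box, `D < d` and `d²` dividing the nonzero value at `t`. -/
def largeDivisorPairs (D N : ℕ) (k : ℤ) : Finset ((ℕ × ℕ × ℕ) × ℕ) :=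
  (box N ×ˢ Finset.Ioc D (3 * N ^ 2 + k.natAbs)).filter fun w =>
    ternary k w.1 ≠ 0 ∧ ((w.2 ^ 2 : ℕ) : ℤ) ∣ ternary k w.1

/-- Counts the triples `(x, d, m)` with `d² m ≤ X` and `d > D`, using `∑ d⁻² ≤ 1 / D` over `d > D`.
-/
lemma card_divisor_triples_le (D N X Y : ℕ) (hD : 1 ≤ D) :
    ((((Finset.Icc 1 N ×ˢ Finset.Ioc D Y).sigma fun w => Finset.Icc 1 (X / w.2 ^ 2)).card : ℕ) : ℝ) ≤
      N * X / D := by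
  rw [Finset.card_sigma]
  simp only [Nat.card_Icc, add_tsub_cancel_right]
  rw [Finset.sum_product]
  simp only [Finset.sum_const, Nat.card_Icc, add_tsub_cancel_right, smul_eq_mul]
  push_cast
  rw [mul_div_assoc]
  refine mul_le_mul_of_nonneg_left ?_ (Nat.cast_nonneg _)
  rcases le_or_gt D Y with hDY | hDY
  · calc ∑ d ∈ Finset.Ioc D Y, ((X / d ^ 2 : ℕ) : ℝ) ≤ ∑ d ∈ Finset.Ioc D Y, X * ((d : ℝ) ^ 2)⁻¹ := by
          refine Finset.sum_le_sum fun d _ => ?_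
          refine Nat.cast_div_le.trans (le_of_eq ?_)
          push_cast
          rw [div_eq_mul_inv]
      _ = X * ∑ d ∈ Finset.Ioc D Y, ((d : ℝ) ^ 2)⁻¹ := by rw [Finset.mul_sum]
      _ ≤ X * (D : ℝ)⁻¹ := by
          refine mul_le_mul_of_nonneg_left ?_ (Nat.cast_nonneg _)
          have := sum_Ioc_inv_sq_le_sub (α := ℝ) (by omega : D ≠ 0) hDY
          have h2 : (0 : ℝ) ≤ (Y : ℝ)⁻¹ := by positivity
          linarith
      _ = _ := by rw [div_eq_mul_inv]
  · rw [Finset.Ioc_eq_empty_of_le hDY.le, Finset.sum_empty]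
    positivity

/-- Send a pair to `(x, d, m)`, where the value is `d² m`. On a fibre `y² + z² = d² m - x² - k` is a
fixed positive integer, at most `2 N²`, so `card_sum_two_squares_le` bounds the fibre. -/
lemma card_largeDivisorPairs_le (D N T : ℕ) (k : ℤ) (hD : 1 ≤ D) (hDk : k.natAbs < D)
    (hT : ∀ n : ℕ, n ≠ 0 → n ≤ 2 * N ^ 2 → n.divisors.card ≤ T) :
    ((largeDivisorPairs D N k).card : ℝ) ≤
      3 * T * T * (N * ((3 * N ^ 2 + k.natAbs : ℕ) : ℝ) / D) := by
  set X := 3 * N ^ 2 + k.natAbs with hX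
  have hpos : ∀ w ∈ largeDivisorPairs D N k, ∃ m : ℕ, 1 ≤ m ∧ m ≤ X / w.2 ^ 2 ∧
      ternary k w.1 = ((w.2 ^ 2 * m : ℕ) : ℤ) := by
    rintro ⟨t, d⟩ hw
    obtain ⟨h1, h2, c, hc⟩ := Finset.mem_filter.1 hw
    obtain ⟨h3, h4⟩ := Finset.mem_product.1 h1
    obtain ⟨h5, -⟩ := Finset.mem_Ioc.1 h4
    simp only at *
    have hd0 : 0 < d := by omega
    have hd2 : k.natAbs < d ^ 2 := by nlinarith
    -- A negative multiple of `d²` would be at most `-d² < -|k| ≤ k`, but the polynomial is at least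
    -- `k`.
    have hcpos : 0 < c := by
      by_contra hcon
      have hc0 : c ≠ 0 := by rintro rfl; exact h2 (by rw [hc, mul_zero])
      have hc1 : c ≤ -1 := by omega
      have h6 : ternary k t ≤ -((d ^ 2 : ℕ) : ℤ) := by rw [hc]; nlinarith
      have h7 : k ≤ ternary k t := by
        unfold ternary
        have : (0 : ℤ) ≤ (t.1 : ℤ) ^ 2 + (t.2.1 : ℤ) ^ 2 + (t.2.2 : ℤ) ^ 2 := by positivity
        linarith
      omega
    lift c to ℕ using hcpos.le
    refine ⟨c, by omega, ?_, by rw [hc]; push_cast; ring⟩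
    rw [Nat.le_div_iff_mul_le (by positivity)]
    have h8 := natAbs_ternary_le h3 k
    rw [hc] at h8
    have h9 : (((d ^ 2 : ℕ) : ℤ) * (c : ℤ)).natAbs = d ^ 2 * c := by
      rw [← Nat.cast_mul, Int.natAbs_natCast]
    rw [h9] at h8
    rwa [mul_comm]
  have hcard : (largeDivisorPairs D N k).card ≤ 3 * T * T *
      ((Finset.Icc 1 N ×ˢ Finset.Ioc D X).sigma fun w => Finset.Icc 1 (X / w.2 ^ 2)).card := by
    refine Finset.card_le_mul_card_image_of_maps_to
      (f := fun w => (⟨(w.1.1, w.2), (ternary k w.1).natAbs / w.2 ^ 2⟩ : (_ : ℕ × ℕ) × ℕ)) ?_ _ ?_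
    · rintro w hw
      obtain ⟨m, hm1, hm2, hm⟩ := hpos w hw
      obtain ⟨h1, -⟩ := Finset.mem_filter.1 hw
      obtain ⟨h3, h4⟩ := Finset.mem_product.1 h1
      have hd0 : 0 < w.2 := by have := (Finset.mem_Ioc.1 h4).1; omega
      rw [Finset.mem_sigma]
      refine ⟨Finset.mem_product.2 ⟨(Finset.mem_product.1 h3).1, h4⟩, ?_⟩
      simp only
      rw [hm, Int.natAbs_natCast, Nat.mul_div_cancel_left _ (by positivity)]
      exact Finset.mem_Icc.2 ⟨hm1, hm2⟩
    · rintro ⟨⟨x, d⟩, m⟩ -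
      set s := (largeDivisorPairs D N k).filter fun w =>
        (⟨(w.1.1, w.2), (ternary k w.1).natAbs / w.2 ^ 2⟩ : (_ : ℕ × ℕ) × ℕ) = ⟨(x, d), m⟩ with hs
      have hmem : ∀ w ∈ s, w.1.1 = x ∧ w.2 = d ∧ ternary k w.1 = ((d ^ 2 * m : ℕ) : ℤ) ∧
          w.1 ∈ box N := by
        intro w hw
        obtain ⟨h1, h2⟩ := Finset.mem_filter.1 hw
        obtain ⟨m', -, -, hm'⟩ := hpos w h1
        obtain ⟨h3, h4⟩ := Finset.mem_product.1 (Finset.mem_filter.1 h1).1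
        have hd0 : 0 < w.2 := by have := (Finset.mem_Ioc.1 h4).1; omega
        rw [hm', Int.natAbs_natCast, Nat.mul_div_cancel_left _ (by positivity)] at h2
        simp only [Sigma.mk.injEq, Prod.mk.injEq, heq_eq_eq] at h2
        obtain ⟨⟨h5, h6⟩, h7⟩ := h2
        exact ⟨h5, h6, by rw [hm', h6, h7], h3⟩
      rcases s.eq_empty_or_nonempty with h0 | ⟨w₀, hw₀⟩
      · simp [h0]
      set n := w₀.1.2.1 ^ 2 + w₀.1.2.2 ^ 2 with hn
      have hrep : ∀ w ∈ s, 0 < w.1.2.1 ∧ 0 < w.1.2.2 ∧ w.1.2.1 ^ 2 + w.1.2.2 ^ 2 = n := by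
        intro w hw
        obtain ⟨a1, -, a3, a4⟩ := hmem w hw
        obtain ⟨b1, -, b3, -⟩ := hmem w₀ hw₀
        rw [mem_box] at a4
        refine ⟨a4.2.1.1, a4.2.2.1, ?_⟩
        have := a3.trans b3.symm
        unfold ternary at this
        rw [a1, b1] at this
        zify
        rw [hn]
        push_cast
        linarith
      have hb₀ := mem_box.1 (hmem w₀ hw₀).2.2.2
      have hn0 : n ≠ 0 := by
        have := hb₀.2.1.1
        positivity
      have hnle : n ≤ 2 * N ^ 2 := by
        have c1 := Nat.pow_le_pow_left hb₀.2.1.2 2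
        have c2 := Nat.pow_le_pow_left hb₀.2.2.2 2
        omega
      have hinj : Set.InjOn (fun w : (ℕ × ℕ × ℕ) × ℕ => w.1.2) s := by
        intro w hw w' hw' h
        obtain ⟨a1, a2, -⟩ := hmem w hw
        obtain ⟨b1, b2, -⟩ := hmem w' hw'
        exact Prod.ext (Prod.ext (a1.trans b1.symm) h) (a2.trans b2.symm)
      rw [← Finset.card_image_of_injOn hinj]
      refine (card_sum_two_squares_le n hn0 _ ?_).trans ?_
      · intro p hp
        obtain ⟨w, hw, rfl⟩ := Finset.mem_image.1 hp
        exact hrep w hw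
      · have := hT n hn0 hnle
        gcongr
  calc ((largeDivisorPairs D N k).card : ℝ) ≤ ((3 * T * T *
      ((Finset.Icc 1 N ×ˢ Finset.Ioc D X).sigma fun w => Finset.Icc 1 (X / w.2 ^ 2)).card : ℕ) : ℝ) := by
        exact_mod_cast hcard
    _ ≤ _ := by
        rw [Nat.cast_mul]
        push_cast
        refine mul_le_mul_of_nonneg_left ?_ (by positivity)
        have := card_divisor_triples_le D N X X hD
        exact_mod_cast this

theorem exists_card_largeDivisorPairs_le (k : ℤ) {ε : ℝ} (hε : 0 < ε) :
    ∃ C : ℝ, 0 ≤ C ∧ ∀ D N : ℕ, 1 ≤ N → 1 ≤ D → k.natAbs < D →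
      ((largeDivisorPairs D N k).card : ℝ) ≤ C * (N : ℝ) ^ ε * ((N : ℝ) ^ 3 / D) := by
  -- The divisor bound `T` for integers up to `2 N²` costs `N ^ (2δ)`, and `T` enters squared.
  set δ := ε / 4 with hδ
  have hδ0 : 0 < δ := by positivity
  obtain ⟨C₁, hC₁, hτ⟩ := exists_card_divisors_le hδ0
  refine ⟨3 * (C₁ * 2 ^ δ) ^ 2 * (3 + k.natAbs), by positivity, fun D N hN hD hDk => ?_⟩
  have hN1 : (1 : ℝ) ≤ N := by exact_mod_cast hN
  set M := (N : ℝ) ^ δ with hM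
  have hbound : ∀ n : ℕ, n ≠ 0 → n ≤ 2 * N ^ 2 →
      n.divisors.card ≤ ⌊C₁ * 2 ^ δ * M ^ 2⌋₊ := by
    intro n hn hn'
    apply Nat.le_floor
    refine (hτ n hn).trans ?_
    have : (n : ℝ) ≤ 2 * (N : ℝ) ^ 2 := by exact_mod_cast hn'
    calc C₁ * (n : ℝ) ^ δ ≤ C₁ * (2 * (N : ℝ) ^ 2) ^ δ := by gcongr
      _ = _ := by
        rw [Real.mul_rpow (by norm_num) (by positivity), hM, ← Real.rpow_natCast,
          ← Real.rpow_natCast, ← Real.rpow_mul (by positivity), ← Real.rpow_mul (by positivity),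
          mul_comm δ]
        ring
  refine (card_largeDivisorPairs_le D N _ k hD hDk hbound).trans ?_
  have hfl : (⌊C₁ * 2 ^ δ * M ^ 2⌋₊ : ℝ) ≤ C₁ * 2 ^ δ * M ^ 2 := Nat.floor_le (by positivity)
  have hMε : (N : ℝ) ^ ε = M ^ 4 := by
    rw [hM, ← Real.rpow_natCast, ← Real.rpow_mul (by positivity), hδ]
    congr 1; push_cast; ring
  have hXle : ((3 * N ^ 2 + k.natAbs : ℕ) : ℝ) ≤ (3 + k.natAbs) * (N : ℝ) ^ 2 := by
    rw [Nat.cast_add, Nat.cast_mul, Nat.cast_pow, add_mul]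
    have : (k.natAbs : ℝ) ≤ k.natAbs * (N : ℝ) ^ 2 :=
      le_mul_of_one_le_right (Nat.cast_nonneg _) (one_le_pow₀ hN1)
    push_cast at this ⊢
    linarith
  rw [hMε]
  calc _ ≤ 3 * (C₁ * 2 ^ δ * M ^ 2) * (C₁ * 2 ^ δ * M ^ 2) *
        (N * ((3 + k.natAbs) * (N : ℝ) ^ 2) / D) := by gcongr
    _ = _ := by ring

open Classical in
/-- The number of points of the box `[1, N]³` at which `x² + y² + z² + k` is square-free. -/
noncomputable def squarefreeCount (N : ℕ) (k : ℤ) : ℕ :=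
  ((box N).filter fun t => Squarefree (ternary k t)).card

/-- The number of points of the box with a nonzero value divisible by `d ^ 2`. -/
def nonzeroCount (d N : ℕ) (k : ℤ) : ℕ :=
  ((box N).filter fun t => ternary k t ≠ 0 ∧ ((d ^ 2 : ℕ) : ℤ) ∣ ternary k t).card

lemma squarefreeCount_eq_sum_moebius (N : ℕ) (k : ℤ) :
    (squarefreeCount N k : ℤ) = ∑ d ∈ Finset.Icc 1 (3 * N ^ 2 + k.natAbs),
      ArithmeticFunction.moebius d * (nonzeroCount d N k : ℤ) := by
  classical
  have h1 : (squarefreeCount N k : ℤ) =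
      ∑ t ∈ (box N).filter (fun t => ternary k t ≠ 0), if Squarefree (ternary k t) then 1 else 0 := by
    rw [squarefreeCount, Finset.sum_boole, Finset.filter_filter]
    congr 2
    ext t
    simp only [Finset.mem_filter]
    exact and_congr_right fun _ => ⟨fun h => ⟨h.ne_zero, by convert h⟩, fun h => by convert h.2⟩
  rw [h1]
  calc _ = ∑ t ∈ (box N).filter (fun t => ternary k t ≠ 0),
        ∑ d ∈ Finset.Icc 1 (3 * N ^ 2 + k.natAbs),
          if ((d ^ 2 : ℕ) : ℤ) ∣ ternary k t then ArithmeticFunction.moebius d else 0 := by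
        refine Finset.sum_congr rfl fun t ht => ?_
        obtain ⟨ht1, ht2⟩ := Finset.mem_filter.1 ht
        rw [← sum_moebius_sq_dvd ht2 (natAbs_ternary_le ht1 k), Finset.sum_filter]
    _ = _ := by
        rw [Finset.sum_comm]
        refine Finset.sum_congr rfl fun d _ => ?_
        rw [← Finset.sum_filter, Finset.filter_filter, Finset.sum_const, nsmul_eq_mul, mul_comm]
        rfl

lemma boxCount_sq_eq (d N : ℕ) (k : ℤ) :
    boxCount (d ^ 2) N k =
      nonzeroCount d N k + ((box N).filter fun t => ternary k t = 0).card := by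
  have h : boxCount (d ^ 2) N k =
      ((box N).filter fun t => ((d ^ 2 : ℕ) : ℤ) ∣ ternary k t).card := rfl
  rw [h, nonzeroCount, ← Finset.card_union_of_disjoint]
  · congr 1
    ext t
    simp only [Finset.mem_filter, Finset.mem_union]
    by_cases h0 : ternary k t = 0
    · simp [h0]
    · simp [h0]
  · rw [Finset.disjoint_filter]
    exact fun t _ h1 h2 => h1.1 h2

lemma sum_nonzeroCount_eq_card (D N : ℕ) (k : ℤ) :
    ∑ d ∈ Finset.Ioc D (3 * N ^ 2 + k.natAbs), nonzeroCount d N k =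
      (largeDivisorPairs D N k).card := by
  rw [largeDivisorPairs, Finset.card_filter, Finset.sum_product_right]
  refine Finset.sum_congr rfl fun d _ => ?_
  rw [nonzeroCount, Finset.card_filter]

lemma abs_moebius_cast_le_one (d : ℕ) : |((ArithmeticFunction.moebius d : ℤ) : ℝ)| ≤ 1 := by
  rw [← Int.cast_abs]
  exact_mod_cast ArithmeticFunction.abs_moebius_le_one

/-- `boxCount` includes the zeros of the polynomial for every modulus, which costs `|k|³` for each
`d ≤ D`; the range `d > D` is bounded in absolute value by the number of pairs. -/
lemma abs_squarefreeCount_sub_le (D N : ℕ) (k : ℤ) (hD : D ≤ 3 * N ^ 2 + k.natAbs) :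
    |(squarefreeCount N k : ℝ) -
      ∑ d ∈ Finset.Icc 1 D, (ArithmeticFunction.moebius d : ℝ) * boxCount (d ^ 2) N k| ≤
      D * (k.natAbs : ℝ) ^ 3 + (largeDivisorPairs D N k).card := by
  set Z := ((box N).filter fun t => ternary k t = 0).card with hZ
  have hZle : (Z : ℝ) ≤ (k.natAbs : ℝ) ^ 3 := by exact_mod_cast card_ternary_eq_zero_le N k
  have h1 : (squarefreeCount N k : ℝ) = ∑ d ∈ Finset.Icc 1 (3 * N ^ 2 + k.natAbs),
      (ArithmeticFunction.moebius d : ℝ) * (nonzeroCount d N k : ℝ) := by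
    exact_mod_cast squarefreeCount_eq_sum_moebius N k
  have hsplit : ∑ d ∈ Finset.Icc 1 (3 * N ^ 2 + k.natAbs),
      (ArithmeticFunction.moebius d : ℝ) * (nonzeroCount d N k : ℝ) =
      ∑ d ∈ Finset.Icc 1 D, (ArithmeticFunction.moebius d : ℝ) * (nonzeroCount d N k : ℝ) +
      ∑ d ∈ Finset.Ioc D (3 * N ^ 2 + k.natAbs),
        (ArithmeticFunction.moebius d : ℝ) * (nonzeroCount d N k : ℝ) :=
    (Finset.sum_Ioc_consecutive (fun d => (ArithmeticFunction.moebius d : ℝ) *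
      (nonzeroCount d N k : ℝ)) (Nat.zero_le D) hD).symm
  have h2 : (squarefreeCount N k : ℝ) -
      ∑ d ∈ Finset.Icc 1 D, (ArithmeticFunction.moebius d : ℝ) * boxCount (d ^ 2) N k =
      -∑ d ∈ Finset.Icc 1 D, (ArithmeticFunction.moebius d : ℝ) * Z +
      ∑ d ∈ Finset.Ioc D (3 * N ^ 2 + k.natAbs),
        (ArithmeticFunction.moebius d : ℝ) * (nonzeroCount d N k : ℝ) := by
    rw [h1, hsplit]
    simp only [boxCount_sq_eq, Nat.cast_add, mul_add, Finset.sum_add_distrib, ← hZ]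
    ring
  rw [h2]
  refine (abs_add_le _ _).trans (add_le_add ?_ ?_)
  · rw [abs_neg]
    refine (Finset.abs_sum_le_sum_abs _ _).trans ?_
    calc _ ≤ ∑ d ∈ Finset.Icc 1 D, (k.natAbs : ℝ) ^ 3 := by
          refine Finset.sum_le_sum fun d _ => ?_
          rw [abs_mul, Nat.abs_cast]
          calc _ ≤ 1 * (Z : ℝ) :=
                mul_le_mul_of_nonneg_right (abs_moebius_cast_le_one d) (Nat.cast_nonneg _)
            _ ≤ _ := by rw [one_mul]; exact hZle
      _ = _ := by simp
  · refine (Finset.abs_sum_le_sum_abs _ _).trans ?_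
    rw [← sum_nonzeroCount_eq_card]
    push_cast
    refine Finset.sum_le_sum fun d _ => ?_
    rw [abs_mul, Nat.abs_cast]
    exact mul_le_of_le_one_left (Nat.cast_nonneg _) (abs_moebius_cast_le_one d)

lemma abs_sum_boxCount_sub_le (D N : ℕ) (k : ℤ) :
    |∑ d ∈ Finset.Icc 1 D, (ArithmeticFunction.moebius d : ℝ) * boxCount (d ^ 2) N k -
      (∑ d ∈ Finset.Icc 1 D, singularTerm k d) * (N : ℝ) ^ 3| ≤
      ∑ d ∈ (Finset.Icc 1 D).filter Squarefree, |boxError d N k| := by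
  rw [Finset.sum_mul, ← Finset.sum_sub_distrib, Finset.sum_filter]
  refine (Finset.abs_sum_le_sum_abs _ _).trans (Finset.sum_le_sum fun d hd => ?_)
  have hd0 : d ≠ 0 := by have := (Finset.mem_Icc.1 hd).1; omega
  have : NeZero d := ⟨hd0⟩
  split_ifs with hsf
  · have e : (ArithmeticFunction.moebius d : ℝ) * boxCount (d ^ 2) N k -
        singularTerm k d * (N : ℝ) ^ 3 = (ArithmeticFunction.moebius d : ℝ) * boxError d N k := by
      simp only [singularTerm, boxError, hd0, dif_neg, not_false_eq_true, lambda_eq_card_quadric]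
      ring
    rw [e, abs_mul]
    exact mul_le_of_le_one_left (abs_nonneg _) (abs_moebius_cast_le_one d)
  · simp [singularTerm, ArithmeticFunction.moebius_eq_zero_of_not_squarefree hsf]

/-! ### Choice of the cut and the asymptotic formula -/

theorem exists_abs_squarefreeCount_sub_le (k : ℤ) {ε : ℝ} (hε : 0 < ε) :
    ∃ C : ℝ, 0 ≤ C ∧ ∃ N₀ : ℕ, 1 ≤ N₀ ∧ ∀ N : ℕ, N₀ ≤ N →
      |(squarefreeCount N k : ℝ) - (∑' d, singularTerm k d) * (N : ℝ) ^ 3| ≤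
        C * (N : ℝ) ^ ((9 : ℝ) / 4 + ε) := by
  -- The tail bound loses `D ^ (2δ)`, which must not exceed `N ^ ε`, and it requires `δ ≤ 1 / 4`.
  set δ := min (ε / 2) (1 / 4) with hδ
  have hδ0 : 0 < δ := by positivity
  have hδε : 2 * δ ≤ ε := by have := min_le_left (ε / 2) (1 / 4 : ℝ); linarith
  obtain ⟨C₁, hC₁, hlarge⟩ := exists_card_largeDivisorPairs_le k hε
  obtain ⟨C₂, hC₂, herr⟩ := exists_sum_abs_boxError_le hε
  obtain ⟨C₃, hC₃, htail⟩ := exists_singularTerm_tail_le hδ0 (min_le_right _ _)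
  -- The threshold gives `N ^ (1/2) ≥ |k| + 1`, hence `D > |k|`, as the bound for large `d`
  -- requires. The factors 2 come from `X ≤ 2 D`, lost in rounding `N ^ (3/4)` down to `D`.
  refine ⟨(k.natAbs : ℝ) ^ 3 + 2 * C₁ + 3 * C₂ + 2 * C₃, by positivity, (k.natAbs + 1) ^ 2,
    Nat.one_le_pow _ _ (by omega), fun N hN => ?_⟩
  have hN1 : 1 ≤ N := (Nat.one_le_pow _ _ (by omega)).trans hN
  have hN1' : (1 : ℝ) ≤ N := by exact_mod_cast hN1
  have hN0 : (0 : ℝ) < N := by linarith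
  set X : ℝ := (N : ℝ) ^ ((3 : ℝ) / 4) with hX
  set P : ℝ := (N : ℝ) ^ ((9 : ℝ) / 4) with hP
  set E : ℝ := (N : ℝ) ^ ε with hE
  have hX1 : 1 ≤ X := Real.one_le_rpow hN1' (by norm_num)
  have hE1 : 1 ≤ E := Real.one_le_rpow hN1' hε.le
  have hP0 : 0 < P := by positivity
  have hX3 : X ^ 3 = P := by
    rw [hX, hP, ← Real.rpow_natCast, ← Real.rpow_mul hN0.le]; norm_num
  have hN3 : (N : ℝ) ^ 3 = P * X := by
    rw [hX, hP, ← Real.rpow_add hN0, ← Real.rpow_natCast]; norm_num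
  have hXP : X ≤ P := Real.rpow_le_rpow_of_exponent_le hN1' (by norm_num)
  have hXN : X ≤ N := by
    conv_rhs => rw [← Real.rpow_one (N : ℝ)]
    exact Real.rpow_le_rpow_of_exponent_le hN1' (by norm_num)
  have hN2 : (N : ℝ) ^ 2 ≤ P := by
    rw [← Real.rpow_natCast]
    exact Real.rpow_le_rpow_of_exponent_le hN1' (by norm_num)
  set D := ⌊X⌋₊ with hD
  have hDX : (D : ℝ) ≤ X := Nat.floor_le (by positivity)
  have hD1 : 1 ≤ D := Nat.le_floor (by exact_mod_cast hX1)
  have hD1' : (1 : ℝ) ≤ D := by exact_mod_cast hD1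
  have hD0 : (0 : ℝ) < D := by linarith
  have hXD : X ≤ 2 * D := by
    have := Nat.lt_floor_add_one X
    rw [← hD] at this
    linarith
  have hDN : D ≤ N := by exact_mod_cast hDX.trans hXN
  have hDk : k.natAbs < D := by
    refine Nat.le_floor ?_
    have h1 : ((k.natAbs + 1 : ℕ) : ℝ) ^ 2 ≤ N := by exact_mod_cast hN
    calc ((k.natAbs + 1 : ℕ) : ℝ) = (((k.natAbs + 1 : ℕ) : ℝ) ^ 2) ^ ((1 : ℝ) / 2) := by
          rw [← Real.rpow_natCast, ← Real.rpow_mul (Nat.cast_nonneg _)]; norm_num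
      _ ≤ (N : ℝ) ^ ((1 : ℝ) / 2) := by gcongr
      _ ≤ X := Real.rpow_le_rpow_of_exponent_le hN1' (by norm_num)
  have hDY : D ≤ 3 * N ^ 2 + k.natAbs := by
    have := Nat.le_self_pow two_ne_zero N
    omega
  have b1 := abs_squarefreeCount_sub_le D N k hDY
  have b2 := abs_sum_boxCount_sub_le D N k
  have b3 := (htail k).2 D hD1
  have b4 := hlarge D N hN1 hD1 hDk
  have b5 := herr k D N hD1 hDN
  have hND : (N : ℝ) ^ 3 / D ≤ 2 * P := by
    rw [div_le_iff₀ hD0, hN3]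
    nlinarith
  have c1 : D * (k.natAbs : ℝ) ^ 3 ≤ (k.natAbs : ℝ) ^ 3 * (P * E) := by
    have : (D : ℝ) ≤ P * E := by nlinarith
    rw [mul_comm]
    gcongr
  have c2 : C₁ * E * ((N : ℝ) ^ 3 / D) ≤ 2 * C₁ * (P * E) := by
    calc _ ≤ C₁ * E * (2 * P) := by gcongr
      _ = _ := by ring
  have c3 : C₂ * E * ((D : ℝ) ^ 3 + N * D + (N : ℝ) ^ 2) ≤ 3 * C₂ * (P * E) := by
    have d1 : (D : ℝ) ^ 3 ≤ P := by rw [← hX3]; gcongr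
    have d2 : (N : ℝ) * D ≤ P := by
      refine le_trans ?_ hN2
      rw [sq]
      gcongr
    calc _ ≤ C₂ * E * (P + P + P) := by gcongr
      _ = _ := by ring
  have c4 : C₃ * (D : ℝ) ^ (-1 + 2 * δ) * (N : ℝ) ^ 3 ≤ 2 * C₃ * (P * E) := by
    have d1 : (D : ℝ) ^ (-1 + 2 * δ) ≤ E / D := by
      rw [Real.rpow_add hD0, Real.rpow_neg_one, div_eq_inv_mul]
      refine mul_le_mul_of_nonneg_left ?_ (by positivity)
      calc (D : ℝ) ^ (2 * δ) ≤ (N : ℝ) ^ (2 * δ) := by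
            have : (D : ℝ) ≤ N := by exact_mod_cast hDN
            gcongr
        _ ≤ _ := Real.rpow_le_rpow_of_exponent_le hN1' hδε
    calc _ ≤ C₃ * (E / D) * (N : ℝ) ^ 3 := by gcongr
      _ = C₃ * E * ((N : ℝ) ^ 3 / D) := by ring
      _ ≤ C₃ * E * (2 * P) := by gcongr
      _ = _ := by ring
  have b3' : |(∑ d ∈ Finset.Icc 1 D, singularTerm k d) * (N : ℝ) ^ 3 -
      (∑' d, singularTerm k d) * (N : ℝ) ^ 3| ≤ C₃ * (D : ℝ) ^ (-1 + 2 * δ) * (N : ℝ) ^ 3 := by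
    rw [← sub_mul, abs_mul, abs_of_nonneg (by positivity : (0 : ℝ) ≤ (N : ℝ) ^ 3)]
    gcongr
  rw [Real.rpow_add hN0, ← hP, ← hE]
  calc _ ≤ |(squarefreeCount N k : ℝ) -
      ∑ d ∈ Finset.Icc 1 D, (ArithmeticFunction.moebius d : ℝ) * boxCount (d ^ 2) N k| +
      |∑ d ∈ Finset.Icc 1 D, (ArithmeticFunction.moebius d : ℝ) * boxCount (d ^ 2) N k -
      (∑ d ∈ Finset.Icc 1 D, singularTerm k d) * (N : ℝ) ^ 3| +
      |(∑ d ∈ Finset.Icc 1 D, singularTerm k d) * (N : ℝ) ^ 3 -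
      (∑' d, singularTerm k d) * (N : ℝ) ^ 3| := by
        refine (abs_sub_le _ _ _).trans (add_le_add_left (abs_sub_le _ _ _) _)
    _ ≤ _ := by linarith

theorem theorem2 (k : ℤ) (ε : ℝ) (hε : 0 < ε) :
    Multipliable (fun p : Nat.Primes =>
      (1 : ℝ) - (lambda ((p : ℕ) ^ 2) k : ℝ) / ((p : ℕ) : ℝ) ^ 6) ∧
    (fun H : ℝ => (S3 H k : ℝ) -
        (∏' p : Nat.Primes,
          ((1 : ℝ) - (lambda ((p : ℕ) ^ 2) k : ℝ) / ((p : ℕ) : ℝ) ^ 6)) * H ^ 3)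
      =O[Filter.atTop] (fun H : ℝ => H ^ ((9 : ℝ) / 4 + ε)) := by
  have hprod := hasProd_singular k
  refine ⟨hprod.multipliable, ?_⟩
  rw [hprod.tprod_eq]
  set c := ∑' d, singularTerm k d with hc
  obtain ⟨C, hC, N₀, hN₀, hmain⟩ := exists_abs_squarefreeCount_sub_le k hε
  -- The extra `3 |c|` pays for replacing `N = ⌊H⌋` by `H` in the main term, since `H³ - N³ ≤ 3 H²`.
  refine Asymptotics.IsBigO.of_bound (C + 3 * |c|) ?_
  filter_upwards [Filter.eventually_ge_atTop (N₀ : ℝ)] with H hH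
  have hH1 : (1 : ℝ) ≤ H := le_trans (by exact_mod_cast hN₀) hH
  have hH0 : (0 : ℝ) < H := by linarith
  set N := ⌊H⌋₊ with hN
  have hNle : (N : ℝ) ≤ H := Nat.floor_le hH0.le
  have hNlt : H < N + 1 := Nat.lt_floor_add_one H
  have hS : S3 H k = squarefreeCount N k := rfl
  have h1 := hmain N (Nat.le_floor hH)
  have h2 : (N : ℝ) ^ ((9 : ℝ) / 4 + ε) ≤ H ^ ((9 : ℝ) / 4 + ε) := by gcongr
  have h3 : |c * (N : ℝ) ^ 3 - c * H ^ 3| ≤ 3 * |c| * H ^ ((9 : ℝ) / 4 + ε) := by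
    have h4 : |(N : ℝ) ^ 3 - H ^ 3| ≤ 3 * H ^ 2 := by
      have hN0 : (0 : ℝ) ≤ N := Nat.cast_nonneg N
      have h5 : (N : ℝ) ^ 3 ≤ H ^ 3 := by gcongr
      rw [abs_sub_comm, abs_of_nonneg (by linarith)]
      have h6 : H ^ 3 - (N : ℝ) ^ 3 = (H - N) * (H ^ 2 + H * N + (N : ℝ) ^ 2) := by ring
      rw [h6]
      have h7 : H ^ 2 + H * N + (N : ℝ) ^ 2 ≤ 3 * H ^ 2 := by nlinarith
      calc _ ≤ 1 * (H ^ 2 + H * N + (N : ℝ) ^ 2) := by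
            gcongr
            linarith
        _ ≤ _ := by rw [one_mul]; exact h7
    have h8 : H ^ 2 ≤ H ^ ((9 : ℝ) / 4 + ε) := by
      rw [← Real.rpow_natCast]
      exact Real.rpow_le_rpow_of_exponent_le hH1 (by push_cast; linarith)
    rw [← mul_sub, abs_mul]
    calc _ ≤ |c| * (3 * H ^ ((9 : ℝ) / 4 + ε)) := by
          gcongr
          linarith
      _ = _ := by ring
  rw [hS, Real.norm_eq_abs, Real.norm_eq_abs,
    abs_of_nonneg (by positivity : (0 : ℝ) ≤ H ^ ((9 : ℝ) / 4 + ε))]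
  calc _ ≤ |(squarefreeCount N k : ℝ) - c * (N : ℝ) ^ 3| + |c * (N : ℝ) ^ 3 - c * H ^ 3| :=
        abs_sub_le _ _ _
    _ ≤ C * H ^ ((9 : ℝ) / 4 + ε) + 3 * |c| * H ^ ((9 : ℝ) / 4 + ε) := by
        refine add_le_add (h1.trans ?_) h3
        gcongr
    _ = _ := by ring
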